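/- Let $u,v$ be functions of $x,t$, let subscripts $x$ denote $x$-derivatives, let $D=\mathrm d/\mathrm dx$ be the total $x$-derivative, and let $\delta_u,\delta_v$ denote variational derivatives. The two-component system $$u_t=u_{xxx}+3u_{xx}u+3u_x^2+3u_xu^2+v_{xx}+u_xv+uv_x,$$ $$v_t=v_{xxx}-3v_{xx}u+3u_{xx}v+6uu_xv+3u^2v_x+4vv_x$$ is bi-Hamiltonian: $$\begin{pmatrix}u_t\\v_t\end{pmatrix}=\mathrm K\begin{pmatrix}\delta_u\\\delta_v\end{pmatrix}\int\frac v2\,\mathrm dx=\mathrm J\begin{pmatrix}\delta_u\\\delta_v\end{pmatrix}\int\Bigl(vu_x+\tfrac12u^2v+\tfrac13v^2\Bigr)\mathrm dx ,$$ where (products denoting compositions of operators) $$\mathrm J=\begin{pmatrix}-\frac13D&D^2+2Du\\-D^2+2uD&4vD+2v_x\end{pmatrix},\qquad \mathrm K=\begin{pmatrix}\mathrm K_1&\mathrm K_2\\\mathrm K_3&\mathrm K_4\end{pmatrix},$$ $$\mathrm K_1=-D^3+u^2D+uu_x-u_xD^{-1}u_x,$$ $$\begin{aligned}\mathrm K_2={}&D^4+4uD^3+(9u_x+3v+5u^2)D^2+(7u_{xx}+5v_x+16uu_x+3uv+2u^3)D\\&+(2u_{xxx}+6u_{xx}u+6u_x^2+6u^2u_x+2v_{xx}+3u_xv+2uv_x)-u_xD^{-1}v_x,\end{aligned}$$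 $$\mathrm K_3=-\mathrm K_2^{*}\quad(\text{the formal adjoint}),$$ $$\begin{aligned}\mathrm K_4={}&6vD^3+9v_xD^2+(7v_{xx}+12u_xv-12v_xu+12u^2v+9v^2)D\\&+(2v_{xxx}-6v_{xx}u+6u_{xx}v+12uu_xv+6u^2v_x+9vv_x)-v_xD^{-1}v_x .\end{aligned}$$ In the first equality $D^{-1}$ is taken with integration constant zero, so that $D^{-1}v_x=v$. The operators $\mathrm J$ and $\mathrm K$ are Hamiltonian and compatible, that is, $a\mathrm K+b\mathrm J$ is Hamiltonian for all constants $a,b$. Here an operator $\mathrm H$ is called Hamiltonian if $\mathrm H^*=-\mathrm H$ and if it satisfies the Jacobi identity: for arbitrary pairs of functions $\xi,\eta,\zeta$, $$\langle\xi,\mathrm H'[\mathrm H\eta]\zeta\rangle+\langle\eta,\mathrm H'[\mathrm H\zeta]\xi\rangle+\langle\zeta,\mathrm H'[\mathrm H\xi]\eta\rangle=0,$$ where $\mathrm H'[Q]$ is the derivative of $\mathrm H$ in the direction $(u,v)\mapsto(u,v)+\varepsilon Q$, and $\langle\xi,\eta\rangle=\int(\xi_1\eta_1+\xi_2\eta_2)\,\mathrm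 dx$ is taken formally, that is, modulo total $x$-derivatives, with $D^{-1}$ skew-adjoint. -/

import Mathlib

open scoped TensorProduct

noncomputable section

namespace BurgersSystem

/-! ### Differential polynomials in two dependent variables -/

/-- Differential polynomials in `u` and `v`: the variable `(0, n)` is the `n`-th `x`-derivative of
`u`, and `(1, n)` is the `n`-th `x`-derivative of `v`. -/
abbrev DiffPoly : Type := MvPolynomial (Fin 2 × ℕ) ℝ

/-- The jet variable `u_n`. -/
def u (n : ℕ) : DiffPoly := MvPolynomial.X (0, n)

/-- The jet variable `v_n`. -/
def v (n : ℕ) : DiffPoly := MvPolynomial.X (1, n)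

/-- The total `x`-derivative. -/
def totalD : Derivation ℝ DiffPoly DiffPoly :=
  MvPolynomial.mkDerivation ℝ fun p => MvPolynomial.X (p.1, p.2 + 1)

/-- The variational derivative `δ_i ∫ h dx = ∑ₙ (-D)ⁿ (∂h / ∂(u_i)_n)`, where `u_0 = u` and
`u_1 = v`. Only those `n` are summed over for which a jet variable of order `n` occurs in `h`;
all other terms vanish. -/
def varDeriv (h : DiffPoly) (i : Fin 2) : DiffPoly :=
  ∑ n ∈ h.vars.image Prod.snd, (-1) ^ n * totalD^[n] (MvPolynomial.pderiv (i, n) h)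

/-! ### Differential operators and weakly nonlocal operators -/

/-- Scalar differential operators; the finitely supported function `L` is `∑ₙ (L n) Dⁿ`. -/
abbrev LocalOp : Type := ℕ →₀ DiffPoly

/-- The operator `a Dⁿ`. -/
def mono (n : ℕ) (a : DiffPoly) : LocalOp := Finsupp.single n a

/-- The composition `L ↦ D ∘ L`, determined by `D ∘ (a Dⁿ) = a Dⁿ⁺¹ + (D a) Dⁿ`. -/
def compD : LocalOp →ₗ[ℝ] LocalOp :=
  Finsupp.lsum ℝ fun n =>
    Finsupp.lsingle (n + 1) + Finsupp.lsingle n ∘ₗ (totalD : DiffPoly →ₗ[ℝ] DiffPoly)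

/-- The formal adjoint of a differential operator, `(a Dⁿ)* = (-1)ⁿ Dⁿ ∘ a`. -/
def localAdjoint : LocalOp →ₗ[ℝ] LocalOp :=
  Finsupp.lsum ℝ fun n => (-1 : ℝ) ^ n • ((compD ^ n) ∘ₗ Finsupp.lsingle 0)

/-- Scalar weakly nonlocal operators `L + ∑ a D⁻¹ b`. The first component is the differential
operator `L`, the second one is `∑ a ⊗ b`, taken over the field of constants because constants
commute with `D⁻¹`. -/
abbrev NonlocalOp : Type := LocalOp × (DiffPoly ⊗[ℝ] DiffPoly)

/-- A differential operator as a weakly nonlocal one. -/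
def ofLocal (L : LocalOp) : NonlocalOp := (L, 0)

/-- The operator `a D⁻¹ b`. -/
def dInv (a b : DiffPoly) : NonlocalOp := (0, a ⊗ₜ[ℝ] b)

/-- The formal adjoint; on the nonlocal part, `(a D⁻¹ b)* = - b D⁻¹ a`. -/
def scalarAdjoint (A : NonlocalOp) : NonlocalOp :=
  (localAdjoint A.1, -(TensorProduct.comm ℝ DiffPoly DiffPoly A.2))

/-- Two by two matrices of weakly nonlocal operators. -/
abbrev MatrixOp : Type := Matrix (Fin 2) (Fin 2) NonlocalOp

/-- The formal adjoint of a matrix operator: the transpose of the matrix of adjoints. -/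
def adjoint (H : MatrixOp) : MatrixOp := Matrix.of fun i j => scalarAdjoint (H j i)

/-! ### The value of a weakly nonlocal operator on a pair of differential polynomials -/

/-- A differential operator applied to a differential polynomial. -/
def localApply (L : LocalOp) (f : DiffPoly) : DiffPoly := L.sum fun n a => a * totalD^[n] f

/-- `HasValue H F G` says that `H F` is defined and equals `G`. If the nonlocal part of the `i`-th
row of `H F` is `∑ a D⁻¹ g`, represented by `∑ a ⊗ g`, it has to be of the form `∑ a ⊗ D f` where
the differential polynomials `f` have no constant term (so that `f` is the antiderivative of `D f`
with the integration constant `0`), and its value is then `∑ a f`. -/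
def HasValue (H : MatrixOp) (F G : Fin 2 → DiffPoly) : Prop :=
  ∃ T : Fin 2 → DiffPoly ⊗[ℝ] DiffPoly, ∀ i,
    LinearMap.lTensor DiffPoly (totalD : DiffPoly →ₗ[ℝ] DiffPoly) (T i) =
        ∑ j, LinearMap.lTensor DiffPoly (LinearMap.mulRight ℝ (F j)) (H i j).2 ∧
      LinearMap.lTensor DiffPoly (MvPolynomial.lcoeff ℝ 0 : DiffPoly →ₗ[ℝ] ℝ) (T i) = 0 ∧
      G i = ∑ j, localApply (H i j).1 (F j) + LinearMap.mul' ℝ DiffPoly (T i)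

/-! ### The Jacobi identity

The operators act on arbitrary "functions": elements of an arbitrary commutative differential
algebra `(B, D)`. The integral of a density in `B` is its class modulo total derivatives, that is,
modulo the range of `D`. -/

section Jacobi

variable {B : Type} [CommRing B] [Algebra ℝ B] (D : Derivation ℝ B B)

/-- The value `a[w]` of a differential polynomial `a` at the pair of functions `w`. -/
def evalJet (w : Fin 2 → B) : DiffPoly →ₐ[ℝ] B :=
  MvPolynomial.aeval fun p => D^[p.2] (w p.1)

/-- The directional derivative of a differential polynomial `a` at `w` along the evolutionary vector
field with the characteristic `Q`: the coefficient of `ε` in `a[w + ε Q]`, where `ε² = 0`. -/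
def variation (w Q : Fin 2 → B) : DiffPoly →ₗ[ℝ] B :=
  (TrivSqZeroExt.sndHom B B).restrictScalars ℝ ∘ₗ
    (MvPolynomial.aeval fun p =>
      (TrivSqZeroExt.inl (D^[p.2] (w p.1)) + TrivSqZeroExt.inr (D^[p.2] (Q p.1)) :
        TrivSqZeroExt B B) : DiffPoly →ₐ[ℝ] TrivSqZeroExt B B).toLinearMap

/-- `P i b` is an antiderivative `D⁻¹ (b[w] ξ_i)`, for all differential polynomials `b`, chosen
linearly in `b`. -/
def IsAntiderivative (w ξ : Fin 2 → B) (P : Fin 2 → DiffPoly →ₗ[ℝ] B) : Prop :=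
  ∀ i b, D (P i b) = evalJet D w b * ξ i

/-- The function `H[w] ξ`, where `P` provides the antiderivatives for `ξ`: a term `a Dⁿ` of the
entry `i j` contributes `a[w] Dⁿ ξ_j`, and a term `a D⁻¹ b` contributes `a[w] D⁻¹ (b[w] ξ_j)`. -/
def applyOp (H : MatrixOp) (w ξ : Fin 2 → B) (P : Fin 2 → DiffPoly →ₗ[ℝ] B) (i : Fin 2) : B :=
  ∑ j, ((H i j).1.sum (fun n a => evalJet D w a * D^[n] (ξ j)) +
    LinearMap.mul' ℝ B (TensorProduct.map (evalJet D w).toLinearMap (P j) (H i j).2))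

/-- A density of the functional `⟨ξ, H'[Q] ζ⟩ = ∫ ∑_{i,j} ξ_i (H'[Q] ζ)_i dx`, where `H'[Q]` is the
directional derivative at `w`, along `Q`, of the operator `H` (of its coefficients), and where `P`
and `R` provide the antiderivatives for `ξ` and `ζ`. With `a'` and `b'` for the directional
derivatives of `a` and `b`, a term `a Dⁿ` of the entry `i j` contributes `ξ_i a' Dⁿ ζ_j`, and a term
`a D⁻¹ b` contributes `ξ_i a' D⁻¹ (b ζ_j) + ξ_i a D⁻¹ (b' ζ_j)`, whose second summand is
`- D⁻¹ (a ξ_i) b' ζ_j` up to a total derivative. -/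
def derivPairing (H : MatrixOp) (w Q ξ : Fin 2 → B) (P : Fin 2 → DiffPoly →ₗ[ℝ] B)
    (ζ : Fin 2 → B) (R : Fin 2 → DiffPoly →ₗ[ℝ] B) : B :=
  ∑ i, ∑ j, ((H i j).1.sum (fun n a => ξ i * variation D w Q a * D^[n] (ζ j)) +
    (ξ i * LinearMap.mul' ℝ B (TensorProduct.map (variation D w Q) (R j) (H i j).2) -
      LinearMap.mul' ℝ B (TensorProduct.map (P i) (variation D w Q) (H i j).2) * ζ j))

end Jacobi

/-- The Jacobi identity for a weakly nonlocal operator: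
`⟨ξ, H'[H η] ζ⟩ + ⟨η, H'[H ζ] ξ⟩ + ⟨ζ, H'[H ξ] η⟩ = 0`, as a functional, for arbitrary functions
`w = (u, v)` and arbitrary pairs of functions `ξ = ξ⁰`, `η = ξ¹`, `ζ = ξ²` for which the
antiderivatives exist, in an arbitrary differential algebra `B`. This includes the free one, which
is generated by the derivatives of `u`, `v`, `ξ`, `η`, `ζ` and by nonlocal variables
`D⁻¹ (b ξ_i)`, `D⁻¹ (b η_i)`, `D⁻¹ (b ζ_i)` that are subject to no other relation than linearity
in `b`. The indices `k + 1` and `k + 2` are cyclic (modulo `3`). -/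
def JacobiIdentity (H : MatrixOp) : Prop :=
  ∀ (B : Type) [CommRing B] [Algebra ℝ B] (D : Derivation ℝ B B) (w : Fin 2 → B)
    (ξ : Fin 3 → Fin 2 → B) (P : Fin 3 → Fin 2 → DiffPoly →ₗ[ℝ] B),
    (∀ k, IsAntiderivative D w (ξ k) (P k)) →
      ∃ S : B, D S = ∑ k : Fin 3,
        derivPairing D H w (applyOp D H w (ξ (k + 1)) (P (k + 1)))
          (ξ k) (P k) (ξ (k + 2)) (P (k + 2))

/-- Hamiltonian operators: skew-adjoint, and satisfying the Jacobi identity. -/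
def IsHamiltonian (H : MatrixOp) : Prop := adjoint H = -H ∧ JacobiIdentity H

/-- Compatibility: every linear combination with constant coefficients is Hamiltonian. -/
def Compatible (H₁ H₂ : MatrixOp) : Prop := ∀ a b : ℝ, IsHamiltonian (a • H₁ + b • H₂)

/-! ### The system, its two operators, and the two Hamiltonian densities -/

/-- The right-hand side of the system. -/
def rhs : Fin 2 → DiffPoly :=
  ![u 3 + 3 * u 2 * u 0 + 3 * u 1 ^ 2 + 3 * u 1 * u 0 ^ 2 + v 2 + u 1 * v 0 + u 0 * v 1,
    v 3 - 3 * v 2 * u 0 + 3 * u 2 * v 0 + 6 * u 0 * u 1 * v 0 + 3 * u 0 ^ 2 * v 1 + 4 * v 0 * v 1]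

/-- The density `v / 2`. -/
def h₀ : DiffPoly := (1 / 2 : ℝ) • v 0

/-- The density `v u_x + u² v / 2 + v² / 3`. -/
def h₁ : DiffPoly :=
  v 0 * u 1 + (1 / 2 : ℝ) • (u 0 ^ 2 * v 0) + (1 / 3 : ℝ) • v 0 ^ 2

/-- The operator `J`; the term `2 D u` of its second entry is the composition `2 D ∘ u`. -/
def opJ : MatrixOp :=
  !![ofLocal (-(1 / 3 : ℝ) • mono 1 1), ofLocal (mono 2 1 + (2 : ℝ) • compD (mono 0 (u 0)));
     ofLocal (-mono 2 1 + mono 1 (2 * u 0)), ofLocal (mono 1 (4 * v 0) + mono 0 (2 * v 1))]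

/-- The entry `K₁`. -/
def opK₁ : NonlocalOp :=
  ofLocal (-mono 3 1 + mono 1 (u 0 ^ 2) + mono 0 (u 0 * u 1)) - dInv (u 1) (u 1)

/-- The entry `K₂`. -/
def opK₂ : NonlocalOp :=
  ofLocal (mono 4 1 + mono 3 (4 * u 0) + mono 2 (9 * u 1 + 3 * v 0 + 5 * u 0 ^ 2) +
    mono 1 (7 * u 2 + 5 * v 1 + 16 * u 0 * u 1 + 3 * u 0 * v 0 + 2 * u 0 ^ 3) +
    mono 0 (2 * u 3 + 6 * u 2 * u 0 + 6 * u 1 ^ 2 + 6 * u 0 ^ 2 * u 1 + 2 * v 2 +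
      3 * u 1 * v 0 + 2 * u 0 * v 1)) - dInv (u 1) (v 1)

/-- The entry `K₃ = - K₂*`. -/
def opK₃ : NonlocalOp := -scalarAdjoint opK₂

/-- The entry `K₄`. -/
def opK₄ : NonlocalOp :=
  ofLocal (mono 3 (6 * v 0) + mono 2 (9 * v 1) +
    mono 1 (7 * v 2 + 12 * u 1 * v 0 - 12 * v 1 * u 0 + 12 * u 0 ^ 2 * v 0 + 9 * v 0 ^ 2) +
    mono 0 (2 * v 3 - 6 * v 2 * u 0 + 6 * u 2 * v 0 + 12 * u 0 * u 1 * v 0 +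
      6 * u 0 ^ 2 * v 1 + 9 * v 0 * v 1)) - dInv (v 1) (v 1)

/-- The operator `K`. -/
def opK : MatrixOp := !![opK₁, opK₂; opK₃, opK₄]

end BurgersSystem

end

/-! Put H = aK + bJ and let ξ, η, ζ be the three arguments. The Jacobi sum is linear in ζ, so it
suffices to free ζ of all derivatives, modulo total derivatives, and to see that its coefficients
vanish. The term ⟨ζ, H'[Hξ]η⟩ is already in this form. In ⟨ξ, H'[Hη]ζ⟩ the local part is moved onto
ξ, since variations of a skew-adjoint operator are skew-adjoint. Finally ⟨η, H'[Q]ξ⟩ = ⟨Q, M⟩ with M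
free of Q, and inserting Q = Hζ gives -⟨ζ, HM⟩ for the local part of H.

The nonlocal part of H is -a times the rank-one operator built from (u_x, v_x), so each argument
enters nonlocally only through one potential. Let θ be the potential D⁻¹(u_x ζ₁ + v_x ζ₂). The terms
containing θ add up to θN, and N turns out to be a total derivative DE, whence θN is equivalent to
-E(u_x ζ₁ + v_x ζ₂). No potential of M is needed. What is left is Aζ₁ + Bζ₂, and A and B vanish
identically.

That M, E exist and that A = B = 0 is a finite computation with integer polynomials in the jets of
u, v, ξ, η, the potentials of ξ and η, and the constants a and c = b/3; the factor 3 clears the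
denominator in J. The kernel performs it in `jacobi_check`. Because a and c are variables there, one
computation covers J, K and all their combinations. The evaluation map `ev` transports the result to
every differential algebra, and `jacobiIdentity_comb` assembles the total derivatives.

Skew-adjointness is a comparison of coefficients on the diagonal; off the diagonal it follows from
`localAdjoint_localAdjoint`. The two forms of the system are direct evaluations. -/

namespace BurgersSystem

/-! ### A computable model of differential polynomials

The functions below are evaluated by the kernel, on polynomials with a few hundred terms; those on
which most of the time is spent are defined by the recursors directly. -/

/-- Polynomials with integer coefficients in variables indexed by `ℕ`, as lists of terms `c m`. A
monomial `m` is the list of its factors. -/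
inductive Poly : Type
  | nil : Poly
  | cons (m : List ℕ) (c : ℤ) (p : Poly) : Poly

namespace Poly

/-- Inserts a factor into a sorted monomial. -/
noncomputable def insertVar (i : ℕ) (m : List ℕ) : List ℕ :=
  List.rec [i] (fun j m r => Bool.rec (j :: r) (i :: j :: m) (Nat.ble i j)) m

noncomputable def mulMono (m n : List ℕ) : List ℕ :=
  List.rec n (fun i _ r => insertVar i r) m

noncomputable def beqMono (m : List ℕ) : List ℕ → Bool :=
  List.rec (fun n => List.rec true (fun _ _ _ => false) n)
    (fun i _ ih n => List.rec false (fun j n _ => Bool.rec false (ih n) (Nat.beq i j)) n) m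

/-- A hash value of a monomial, which keeps the search trees below balanced. -/
noncomputable def hash (m : List ℕ) : ℕ :=
  Nat.mod (List.rec 1 (fun i _ r => Nat.add (Nat.mul r 128) i) m) 1000003

/-- Search trees of terms, ordered by the hash values of the monomials. -/
inductive Tree : Type
  | leaf : Tree
  | node (l : Tree) (k : ℕ) (m : List ℕ) (c : ℤ) (r : Tree) : Tree

/-- `t.force f` is `f t`; the kernel evaluates `t` before it unfolds `f`. -/
noncomputable def Tree.force {α : Type} (t : Tree) (f : Tree → α) : α :=
  Tree.rec (f .leaf) (fun l k m c r _ _ => f (.node l k m c r)) t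

/-- Adds the term `c m`, where `k` is the hash value of `m`. -/
noncomputable def Tree.insert (k : ℕ) (m : List ℕ) (c : ℤ) (t : Tree) : Tree :=
  Tree.rec (.node .leaf k m c .leaf)
    (fun l k' n d r l' r' =>
      Bool.rec
        (Bool.rec (r'.force fun r' => .node l k' n d r') (l'.force fun l' => .node l' k' n d r)
          (Nat.ble k k'))
        (Bool.rec (r'.force fun r' => .node l k' n d r') (.node l k' n (Int.add d c) r)
          (beqMono m n))
        (Nat.beq k k'))
    t

noncomputable def Tree.insertAll (p : Poly) : Tree → Tree :=
  Poly.rec (fun t => t) (fun m c _ ih t => (t.insert (hash m) m c).force ih) p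

/-- The terms of a tree with nonzero coefficients, followed by `p`. -/
def Tree.toPoly : Tree → Poly → Poly
  | .leaf, p => p
  | .node l _ m c r, p =>
    l.toPoly (match c with
      | .ofNat 0 => r.toPoly p
      | c => .cons m c (r.toPoly p))

/-- Collects equal monomials. -/
noncomputable def norm (p : Poly) : Poly := (Tree.insertAll p .leaf).toPoly nil

def const (z : ℤ) : Poly := cons [] z nil

def X (i : ℕ) : Poly := cons [i] 1 nil

noncomputable def add (p q : Poly) : Poly := Poly.rec q (fun m c _ r => cons m c r) p

noncomputable def smul (c : ℤ) (p : Poly) : Poly :=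
  Poly.rec nil (fun m d _ r => cons m (Int.mul c d) r) p

/-- Multiplication by a monomial. -/
noncomputable def shift (m : List ℕ) (p : Poly) : Poly :=
  Poly.rec nil (fun n c _ r => cons (mulMono m n) c r) p

noncomputable def mul : Poly → Poly → Poly
  | nil, _ => nil
  | cons m c p, q => add (smul c (shift m q)) (mul p q)

instance : Zero Poly := ⟨nil⟩
noncomputable instance : Add Poly := ⟨add⟩
noncomputable instance : Mul Poly := ⟨mul⟩
noncomputable instance : Neg Poly := ⟨smul (-1)⟩
noncomputable instance : Sub Poly := ⟨fun p q => add p (smul (-1) q)⟩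

noncomputable def deriveMono (δ : ℕ → Poly) : List ℕ → Poly
  | [] => nil
  | i :: m => add (shift m (δ i)) (shift [i] (deriveMono δ m))

/-- The derivation with the values `δ i` at the variables. -/
noncomputable def derive (δ : ℕ → Poly) : Poly → Poly
  | nil => nil
  | cons m c p => add (smul c (deriveMono δ m)) (derive δ p)

def eraseVar (i : ℕ) : List ℕ → Option (List ℕ)
  | [] => none
  | j :: m => bif Nat.beq i j then some m else
    match eraseVar i m with
    | none => none
    | some n => some (j :: n)

/-- A pair `(q, r)` with `p = X i * q + r`. -/
def split (i : ℕ) : Poly → Poly × Poly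
  | nil => (0, 0)
  | cons m c p =>
    match eraseVar i m with
    | none => ((split i p).1, cons m c (split i p).2)
    | some n => (cons n c (split i p).1, (split i p).2)

def isNil : Poly → Bool
  | nil => true
  | _ => false

theorem eq_zero_of_isNil : ∀ {p : Poly}, isNil p = true → p = 0
  | nil, _ => rfl

/-! ### Evaluation -/

section Eval

variable {A B : Type*} [CommRing A] [CommRing B] (x : ℕ → A)

def evMono (m : List ℕ) : A := (m.map x).prod

/-- The value of a polynomial at `x`. -/
def ev : Poly → A
  | nil => 0
  | cons m c p => c * evMono x m + ev p

theorem evMono_nil : evMono x [] = 1 := rfl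

theorem evMono_cons (i : ℕ) (m : List ℕ) : evMono x (i :: m) = x i * evMono x m := by
  simp [evMono]

theorem evMono_insertVar (i : ℕ) (m : List ℕ) : evMono x (insertVar i m) = x i * evMono x m := by
  induction m with
  | nil => simp [insertVar, evMono]
  | cons j m ih =>
    change evMono x (Bool.rec (j :: insertVar i m) (i :: j :: m) (Nat.ble i j)) = _
    cases Nat.ble i j
    · simp only [evMono_cons, ih]; ring
    · simp only [evMono_cons]

theorem evMono_mulMono (m n : List ℕ) :
    evMono x (mulMono m n) = evMono x m * evMono x n := by
  induction m with
  | nil => simp [mulMono, evMono]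
  | cons i m ih =>
    change evMono x (insertVar i (mulMono m n)) = _
    rw [evMono_insertVar, ih, evMono_cons, mul_assoc]

theorem eq_of_beqMono {m n : List ℕ} (h : beqMono m n = true) : m = n := by
  induction m generalizing n with
  | nil => cases n with
    | nil => rfl
    | cons j n => cases h
  | cons i m ih => cases n with
    | nil => cases h
    | cons j n =>
      change Bool.rec false (beqMono m n) (Nat.beq i j) = true at h
      cases hij : Nat.beq i j with
      | false => rw [hij] at h; cases h
      | true =>
        rw [hij] at h
        rw [Nat.eq_of_beq_eq_true hij, ih h]

/-! ### Search trees preserve values. -/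

namespace Tree

theorem force_eq {α : Type} (t : Tree) (f : Tree → α) : t.force f = f t := by
  cases t <;> rfl

/-- The sum of the terms of a tree. -/
def ev : Tree → A
  | leaf => 0
  | node l _ m c r => ev l + c * evMono x m + ev r

/-- Soundness does not depend on the hash or on the order of the tree: coefficients are merged only
after `beqMono` has confirmed equality, and a collision merely sends the term to the right subtree.
-/
theorem ev_insert (k : ℕ) (m : List ℕ) (c : ℤ) (t : Tree) :
    (t.insert k m c).ev x = t.ev x + c * evMono x m := by
  induction t with
  | leaf => simp [insert, ev]
  | node l k' n d r hl hr =>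
    change ev x (Bool.rec
      (Bool.rec ((r.insert k m c).force fun r' => .node l k' n d r')
        ((l.insert k m c).force fun l' => .node l' k' n d r) (Nat.ble k k'))
      (Bool.rec ((r.insert k m c).force fun r' => .node l k' n d r') (.node l k' n (d + c) r)
        (beqMono m n))
      (Nat.beq k k')) = _
    cases Nat.beq k k' with
    | false =>
      cases Nat.ble k k'
      · simp only [force_eq, ev, hr]; ring
      · simp only [force_eq, ev, hl]; ring
    | true =>
      cases h : beqMono m n
      · simp only [force_eq, ev, hr]; ring
      · simp only [ev, eq_of_beqMono h]; push_cast; ring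

theorem ev_insertAll (p : Poly) (t : Tree) : (insertAll p t).ev x = t.ev x + Poly.ev x p := by
  induction p generalizing t with
  | nil => exact (add_zero _).symm
  | cons m c p ih =>
    change ev x ((t.insert (hash m) m c).force (insertAll p)) = _
    rw [force_eq, ih, ev_insert, Poly.ev, add_assoc]

theorem ev_toPoly (t : Tree) (p : Poly) : Poly.ev x (t.toPoly p) = t.ev x + Poly.ev x p := by
  induction t generalizing p with
  | leaf => simp [toPoly, ev]
  | node l k m c r hl hr =>
    simp only [toPoly, hl, ev]
    split
    · rw [hr]; simp; ring
    · rw [Poly.ev, hr]; ring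

end Tree

@[simp] theorem ev_norm (p : Poly) : ev x (norm p) = ev x p := by
  rw [norm, Tree.ev_toPoly, Tree.ev_insertAll]; simp [Tree.ev, ev]

@[simp] theorem ev_zero : ev x 0 = 0 := rfl

@[simp] theorem ev_const (z : ℤ) : ev x (const z) = z := by simp [const, ev, evMono]

@[simp] theorem ev_X (i : ℕ) : ev x (X i) = x i := by simp [X, ev, evMono]

@[simp] theorem ev_add (p q : Poly) : ev x (p + q) = ev x p + ev x q := by
  change ev x (add p q) = _
  induction p with
  | nil => exact (zero_add _).symm
  | cons m c p ih =>
    change ev x (cons m c (add p q)) = _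
    rw [ev, ev, ih, add_assoc]

theorem ev_smul (c : ℤ) (p : Poly) : ev x (smul c p) = c * ev x p := by
  induction p with
  | nil => exact (mul_zero _).symm
  | cons m d p ih =>
    change ev x (cons m (c * d) (smul c p)) = _
    rw [ev, ev, ih]; push_cast; ring

theorem ev_shift (m : List ℕ) (p : Poly) : ev x (shift m p) = evMono x m * ev x p := by
  induction p with
  | nil => exact (mul_zero _).symm
  | cons n c p ih =>
    change ev x (cons (mulMono m n) c (shift m p)) = _
    rw [ev, ev, ih, evMono_mulMono]; ring

@[simp] theorem ev_mul (p q : Poly) : ev x (p * q) = ev x p * ev x q := by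
  change ev x (mul p q) = _
  induction p with
  | nil => exact (zero_mul _).symm
  | cons m c p ih =>
    change ev x (smul c (shift m q) + mul p q) = _
    rw [ev_add, ev_smul, ev_shift, ih, ev]; ring

@[simp] theorem ev_neg (p : Poly) : ev x (-p) = -ev x p := by
  change ev x (smul (-1) p) = _
  rw [ev_smul]; simp

@[simp] theorem ev_sub (p q : Poly) : ev x (p - q) = ev x p - ev x q := by
  change ev x (p + -q) = _
  rw [ev_add, ev_neg, sub_eq_add_neg]

theorem evMono_of_eraseVar {i : ℕ} {m n : List ℕ} (h : eraseVar i m = some n) :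
    evMono x m = x i * evMono x n := by
  induction m generalizing n with
  | nil => cases h
  | cons j m ih =>
    rw [eraseVar] at h
    cases hij : Nat.beq i j with
    | true =>
      rw [hij] at h
      cases h
      rw [evMono_cons, Nat.eq_of_beq_eq_true hij]
    | false =>
      rw [hij] at h
      cases hm : eraseVar i m with
      | none => rw [hm] at h; cases h
      | some k =>
        rw [hm] at h
        cases h
        rw [evMono_cons, evMono_cons, ih hm]; ring

theorem ev_split (i : ℕ) (p : Poly) :
    x i * ev x (split i p).1 + ev x (split i p).2 = ev x p := by
  induction p with
  | nil => simp [split, ev]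
  | cons m c p ih =>
    rw [split]
    cases h : eraseVar i m with
    | none => simp only [ev]; rw [← ih]; ring
    | some n => simp only [ev]; rw [← ih, evMono_of_eraseVar x h]; ring

/-! ### Transport of values along ring homomorphisms and derivations. -/

variable {x} {y : ℕ → B} {s : ℕ → Bool}

/-- The polynomial `p` involves only variables whose indices satisfy `s`. -/
def involves (s : ℕ → Bool) : Poly → Bool
  | nil => true
  | cons m _ p => m.all s && involves s p

theorem map_ev (φ : A →+* B) (hx : ∀ i, s i = true → φ (x i) = y i) {p : Poly} (hp : p.involves s = true) :
    φ (ev x p) = ev y p := by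
  have hm (m : List ℕ) (h : m.all s = true) : φ (evMono x m) = evMono y m := by
    rw [evMono, map_list_prod, evMono, List.map_map]
    congr 1
    exact List.map_congr_left fun i hi => hx i (List.all_eq_true.1 h i hi)
  induction p with
  | nil => exact map_zero φ
  | cons m c p ih =>
    rw [involves, Bool.and_eq_true] at hp
    rw [ev, ev, map_add, map_mul, map_intCast, hm _ hp.1, ih hp.2]

/-- The Leibniz rule is twisted by `φ` to serve two purposes: `φ` the identity and `d` the
derivation of the algebra, and `φ` the evaluation at a pair of functions and `d` the directional
derivative there. -/
theorem map_ev_derive (φ : A →+* B) (d : A →+ B) (hd : ∀ f g, d (f * g) = φ f * d g + φ g * d f)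
    (hx : ∀ i, s i = true → φ (x i) = y i) (δ : ℕ → Poly) (hδ : ∀ i, s i = true → d (x i) = ev y (δ i))
    {p : Poly} (hp : p.involves s = true) : d (ev x p) = ev y (derive δ p) := by
  have h1 : d 1 = 0 := by simpa using hd 1 1
  have hm (m : List ℕ) (h : m.all s = true) :
      φ (evMono x m) = evMono y m ∧ d (evMono x m) = ev y (deriveMono δ m) := by
    induction m with
    | nil => exact ⟨map_one φ, h1⟩
    | cons i m ih =>
      rw [List.all_cons, Bool.and_eq_true] at h
      obtain ⟨hi, hm⟩ := h
      obtain ⟨h₁, h₂⟩ := ih hm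
      refine ⟨by rw [evMono_cons, evMono_cons, map_mul, h₁, hx i hi], ?_⟩
      change _ = ev y (shift m (δ i) + shift [i] (deriveMono δ m))
      rw [evMono_cons, hd, h₁, h₂, hx i hi, hδ i hi, ev_add, ev_shift, ev_shift, evMono_cons,
        evMono_nil]
      ring
  induction p with
  | nil => exact map_zero d
  | cons m c p ih =>
    rw [involves, Bool.and_eq_true] at hp
    change _ = ev y (smul c (deriveMono δ m) + derive δ p)
    rw [ev, map_add, ih hp.2, ev_add, ev_smul, ← (hm _ hp.1).2, ← zsmul_eq_mul, ← zsmul_eq_mul,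
      map_zsmul]

end Eval

end Poly


/-! ### Differential operators -/

section LocalOp

theorem totalD_u (n : ℕ) : totalD (u n) = u (n + 1) := by
  simp [totalD, u, MvPolynomial.mkDerivation_X]

theorem totalD_v (n : ℕ) : totalD (v n) = v (n + 1) := by
  simp [totalD, v, MvPolynomial.mkDerivation_X]

theorem totalD_ofNat (n : ℕ) [n.AtLeastTwo] : totalD (ofNat(n) : DiffPoly) = 0 :=
  totalD.map_natCast n

theorem compD_mono (n : ℕ) (a : DiffPoly) :
    compD (mono n a) = mono (n + 1) a + mono n (totalD a) := by
  simp [compD, mono]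

theorem localAdjoint_mono (n : ℕ) (a : DiffPoly) :
    localAdjoint (mono n a) = (-1 : ℝ) ^ n • (compD ^ n) (mono 0 a) := by
  simp [localAdjoint, mono]

/-- The composition `L ↦ L ∘ D`. -/
noncomputable def compRight : LocalOp →ₗ[ℝ] LocalOp :=
  Finsupp.lsum ℝ fun n => Finsupp.lsingle (n + 1)

theorem compRight_mono (n : ℕ) (a : DiffPoly) : compRight (mono n a) = mono (n + 1) a := by
  simp [compRight, mono]

theorem localOp_hom_ext {M : Type*} [AddCommGroup M] [Module ℝ M] {f g : LocalOp →ₗ[ℝ] M}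
    (h : ∀ n a, f (mono n a) = g (mono n a)) : f = g :=
  Finsupp.lhom_ext h

theorem compD_compRight (L : LocalOp) : compD (compRight L) = compRight (compD L) := by
  refine LinearMap.congr_fun (f := compD ∘ₗ compRight) (g := compRight ∘ₗ compD)
    (localOp_hom_ext fun n a => ?_) L
  simp [compRight_mono, compD_mono]

theorem compD_pow_compRight (n : ℕ) (L : LocalOp) :
    (compD ^ n) (compRight L) = compRight ((compD ^ n) L) := by
  induction n generalizing L with
  | zero => rfl
  | succ n ih => rw [pow_succ, Module.End.mul_apply, Module.End.mul_apply, compD_compRight, ih]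

/-- The adjoint reverses products and D* = -D. This instance is all that the involution property
requires. -/
theorem localAdjoint_compD (L : LocalOp) : localAdjoint (compD L) = -compRight (localAdjoint L) := by
  refine LinearMap.congr_fun (f := localAdjoint ∘ₗ compD) (g := -(compRight ∘ₗ localAdjoint))
    (localOp_hom_ext fun n a => ?_) L
  have h : (compD ^ (n + 1)) (mono 0 a) =
      compRight ((compD ^ n) (mono 0 a)) + (compD ^ n) (mono 0 (totalD a)) := by
    rw [pow_succ, Module.End.mul_apply, compD_mono, map_add, ← compD_pow_compRight,
      compRight_mono]
  simp only [LinearMap.comp_apply, LinearMap.neg_apply, compD_mono, map_add, localAdjoint_mono, h,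
    map_smul]
  module

/-- Iterating the previous rule turns the adjoint of Dᵏ ∘ a into (-1)ᵏ a Dᵏ, and the two signs
cancel. It is needed because K₃ is given only as -K₂*. -/
theorem localAdjoint_localAdjoint (L : LocalOp) : localAdjoint (localAdjoint L) = L := by
  refine LinearMap.congr_fun (f := localAdjoint ∘ₗ localAdjoint) (g := LinearMap.id)
    (localOp_hom_ext fun n a => ?_) L
  have h (k : ℕ) (M : LocalOp) : localAdjoint ((compD ^ k) M) =
      (-1 : ℝ) ^ k • (compRight ^ k) (localAdjoint M) := by
    induction k generalizing M with
    | zero => simp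
    | succ k ih =>
      rw [pow_succ, Module.End.mul_apply, ih, localAdjoint_compD, map_neg,
        pow_succ compRight, Module.End.mul_apply, pow_succ]
      module
  have h' (k : ℕ) : (compRight ^ k) (mono 0 a) = mono k a := by
    induction k with
    | zero => rfl
    | succ k ih => rw [pow_succ', Module.End.mul_apply, ih, compRight_mono]
  have h0 : localAdjoint (mono 0 a) = mono 0 a := by simp [localAdjoint_mono]
  simp only [LinearMap.comp_apply, LinearMap.id_apply, localAdjoint_mono, map_smul, h, h0, h',
    smul_smul, ← mul_pow]
  simp

theorem scalarAdjoint_scalarAdjoint (A : NonlocalOp) : scalarAdjoint (scalarAdjoint A) = A := by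
  refine Prod.ext (localAdjoint_localAdjoint A.1) ?_
  change -(TensorProduct.comm ℝ DiffPoly DiffPoly (-(TensorProduct.comm ℝ DiffPoly DiffPoly A.2))) = _
  rw [map_neg, neg_neg]
  exact (TensorProduct.comm ℝ DiffPoly DiffPoly).symm_apply_apply A.2

theorem scalarAdjoint_add (A B : NonlocalOp) :
    scalarAdjoint (A + B) = scalarAdjoint A + scalarAdjoint B := by
  refine Prod.ext (map_add _ _ _) ?_
  change -(TensorProduct.comm ℝ DiffPoly DiffPoly (A.2 + B.2)) = -_ + -_
  rw [map_add, neg_add]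

theorem scalarAdjoint_smul (c : ℝ) (A : NonlocalOp) :
    scalarAdjoint (c • A) = c • scalarAdjoint A := by
  refine Prod.ext (map_smul _ _ _) ?_
  change -(TensorProduct.comm ℝ DiffPoly DiffPoly (c • A.2)) = c • -_
  rw [map_smul, smul_neg]

theorem scalarAdjoint_neg (A : NonlocalOp) : scalarAdjoint (-A) = -scalarAdjoint A := by
  rw [← neg_one_smul ℝ A, scalarAdjoint_smul, ← neg_one_smul ℝ (scalarAdjoint A)]

theorem scalarAdjoint_ofLocal (L : LocalOp) : scalarAdjoint (ofLocal L) = ofLocal (localAdjoint L) := by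
  simp [scalarAdjoint, ofLocal]

theorem scalarAdjoint_dInv (a b : DiffPoly) : scalarAdjoint (dInv a b) = -dInv b a := by
  simp [scalarAdjoint, dInv]

theorem ofLocal_neg (L : LocalOp) : ofLocal (-L) = -ofLocal L := by
  simp [ofLocal]

/-! ### Skew-adjointness of K, of J and of their combinations. -/

theorem scalarAdjoint_opK₁ : scalarAdjoint opK₁ = -opK₁ := by
  have h : localAdjoint (-mono 3 1 + mono 1 (u 0 ^ 2) + mono 0 (u 0 * u 1)) =
      -(-mono 3 1 + mono 1 (u 0 ^ 2) + mono 0 (u 0 * u 1)) := by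
    ext1 n
    rcases n with _ | _ | _ | _ | n <;>
    simp [localAdjoint_mono, compD_mono, pow_succ, totalD_u] <;>
    simp [mono]
  rw [opK₁, sub_eq_add_neg, scalarAdjoint_add, scalarAdjoint_neg, scalarAdjoint_dInv,
    scalarAdjoint_ofLocal, h, ofLocal_neg]
  abel

theorem scalarAdjoint_opK₄ : scalarAdjoint opK₄ = -opK₄ := by
  rw [opK₄, sub_eq_add_neg, scalarAdjoint_add, scalarAdjoint_neg, scalarAdjoint_dInv,
    scalarAdjoint_ofLocal, neg_add, ← ofLocal_neg]
  congr 2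
  ext1 n
  rcases n with _ | _ | _ | _ | n <;>
  simp [localAdjoint_mono, compD_mono, pow_succ, totalD_u, totalD_v, totalD_ofNat] <;> simp [mono] <;> ring

/-- Only the diagonal entries need a computation; the others are skew by the choice of K₃ and the
involution property. -/
theorem adjoint_opK : adjoint opK = -opK := by
  ext1 i j
  fin_cases i <;> fin_cases j
  · exact scalarAdjoint_opK₁
  · change scalarAdjoint (-scalarAdjoint opK₂) = -opK₂
    rw [scalarAdjoint_neg, scalarAdjoint_scalarAdjoint]
  · exact (neg_neg _).symm
  · exact scalarAdjoint_opK₄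

theorem opJ_one_zero : opJ 1 0 = -scalarAdjoint (opJ 0 1) := by
  have h2 : (MvPolynomial.C 2 : DiffPoly) = 2 := map_ofNat MvPolynomial.C 2
  change ofLocal _ = -scalarAdjoint (ofLocal _)
  rw [scalarAdjoint_ofLocal, ← ofLocal_neg]
  congr 1
  ext1 n
  rcases n with _ | _ | _ | n <;>
  simp [localAdjoint_mono, compD_mono, pow_succ, totalD_u] <;> simp [mono] <;>
  simp [MvPolynomial.smul_eq_C_mul, h2]

theorem adjoint_opJ : adjoint opJ = -opJ := by
  ext1 i j
  fin_cases i <;> fin_cases j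
  · change scalarAdjoint (ofLocal _) = -ofLocal _
    rw [scalarAdjoint_ofLocal, ← ofLocal_neg]
    congr 1
    simp [localAdjoint_mono, compD_mono]
    simp [mono]
  · change scalarAdjoint (opJ 1 0) = -opJ 0 1
    rw [opJ_one_zero, scalarAdjoint_neg, scalarAdjoint_scalarAdjoint]
  · change scalarAdjoint (opJ 0 1) = -opJ 1 0
    rw [opJ_one_zero, neg_neg]
  · change scalarAdjoint (ofLocal _) = -ofLocal _
    rw [scalarAdjoint_ofLocal, ← ofLocal_neg]
    congr 1
    ext1 n
    rcases n with _ | _ | n <;>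
    simp [localAdjoint_mono, compD_mono, totalD_v, totalD_ofNat] <;> simp [mono] <;> ring

theorem adjoint_smul_add_smul {H₁ H₂ : MatrixOp} (h₁ : adjoint H₁ = -H₁) (h₂ : adjoint H₂ = -H₂)
    (a b : ℝ) : adjoint (a • H₁ + b • H₂) = -(a • H₁ + b • H₂) := by
  ext1 i j
  have h₁' : scalarAdjoint (H₁ j i) = -H₁ i j := congr_fun (congr_fun h₁ i) j
  have h₂' : scalarAdjoint (H₂ j i) = -H₂ i j := congr_fun (congr_fun h₂ i) j
  change scalarAdjoint (a • H₁ j i + b • H₂ j i) = -(a • H₁ i j + b • H₂ i j)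
  rw [scalarAdjoint_add, scalarAdjoint_smul, scalarAdjoint_smul, h₁', h₂']
  module

end LocalOp


namespace Poly

/-! ### The Jacobi identity in the computable model

The variable with the index `16 * n + f` is the `n`-th derivative of the variable `f`. The variables
`0`, `1` are `u`, `v`; the pairs `(2, 3)`, `(4, 5)` and `(6, 7)` are `ξ`, `η` and a pair of
functions `Q`; the variables `8`, `9` are `D⁻¹ (u_x ξ₁ + v_x ξ₂)`, `D⁻¹ (u_x η₁ + v_x η₂)`, and
`10`, `11` are the constants `a`, `c` in the operator `a K + 3 c J`. -/

/-- The derivative of a variable. -/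
noncomputable def dVar (i : ℕ) : Poly :=
  bif Nat.ble 8 i && Nat.ble i 11 then
    bif Nat.ble i 9 then
      -- For `i` equal to 8 or 9, `2 * i - 14` and `2 * i - 13` index the pair ξ or η; 16 and 17 are
      -- u_x and v_x.
      cons [2 * i - 14, 16] 1 (cons [2 * i - 13, 17] 1 nil)
    else 0
  else X (i + 16)

/-- The total derivative. -/
noncomputable def der (p : Poly) : Poly := norm (derive dVar p)

/-- Integration by parts, which moves the derivatives off the variables `i + 16` with `i` in the
list. The total derivative of the second component is the difference of the first components. -/
noncomputable def byParts : List ℕ → Poly × Poly → Poly × Poly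
  | [], p => (norm p.1, p.2)
  | i :: l, (p, s) =>
    byParts l ((split (i + 16) p).2 - X i * der (split (i + 16) p).1,
      s + X i * (split (i + 16) p).1)

/-- The value at `f` of the differential operator with the given list of coefficients. -/
noncomputable def act : List Poly → Poly → Poly
  | [], _ => 0
  | a :: L, f => a * f + act L (der f)

/-- The value at `f` of the adjoint of the differential operator with the given list of
coefficients. -/
noncomputable def adj : List Poly → Poly → Poly
  | [], _ => 0
  | a :: L, f => a * f - der (adj L f)

noncomputable def U (n : ℕ) : Poly := X (16 * n)

noncomputable def V (n : ℕ) : Poly := X (16 * n + 1)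

noncomputable def ca : Poly := X 10

noncomputable def cc : Poly := X 11

/-- The local part of the entry `1 1` of `a K + 3 c J`. -/
noncomputable def coeffs₁ : List Poly :=
  [ca * (U 0 * U 1), ca * (U 0 * U 0) - cc, 0, -ca]

/-- The local part of the entry `1 2` of `a K + 3 c J`. -/
noncomputable def coeffs₂ : List Poly :=
  [ca * (const 2 * U 3 + const 6 * (U 2 * U 0) + const 6 * (U 1 * U 1) +
      const 6 * (U 0 * (U 0 * U 1)) + const 2 * V 2 + const 3 * (U 1 * V 0) +
      const 2 * (U 0 * V 1)) + const 6 * (cc * U 1),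
    ca * (const 7 * U 2 + const 5 * V 1 + const 16 * (U 0 * U 1) + const 3 * (U 0 * V 0) +
      const 2 * (U 0 * (U 0 * U 0))) + const 6 * (cc * U 0),
    ca * (const 9 * U 1 + const 3 * V 0 + const 5 * (U 0 * U 0)) + const 3 * cc,
    ca * (const 4 * U 0),
    ca]

/-- The local part of the entry `2 2` of `a K + 3 c J`. -/
noncomputable def coeffs₄ : List Poly :=
  [ca * (const 2 * V 3 - const 6 * (V 2 * U 0) + const 6 * (U 2 * V 0) +
      const 12 * (U 0 * (U 1 * V 0)) + const 6 * (U 0 * (U 0 * V 1)) + const 9 * (V 0 * V 1)) +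
      const 6 * (cc * V 1),
    ca * (const 7 * V 2 + const 12 * (U 1 * V 0) - const 12 * (V 1 * U 0) +
      const 12 * (U 0 * (U 0 * V 0)) + const 9 * (V 0 * V 0)) + const 12 * (cc * V 0),
    ca * (const 9 * V 1),
    ca * (const 6 * V 0)]

/-- The local part of `a K + 3 c J`, with coefficients transformed by `φ`, at the pair `f`. -/
noncomputable def rows (φ : Poly → Poly) (f : Poly × Poly) : Poly × Poly :=
  (act (coeffs₁.map φ) f.1 + act (coeffs₂.map φ) f.2,
    act (coeffs₄.map φ) f.2 - adj (coeffs₂.map φ) f.1)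

/-- The pair `ξ` or `η`. -/
noncomputable def arg (k : ℕ) : Poly × Poly := (X (2 + 2 * k), X (3 + 2 * k))

/-- The nonlocal variable that belongs to `ξ` or `η`. -/
noncomputable def pot (k : ℕ) : Poly := X (8 + k)

/-- The pair `(a K + 3 c J) ξ`, or the same for `η`. -/
noncomputable def hamVal (k : ℕ) : Poly × Poly :=
  (norm ((rows id (arg k)).1 - ca * U 1 * pot k), norm ((rows id (arg k)).2 - ca * V 1 * pot k))

/-- The variations of the variables along `q`. -/
noncomputable def varyVar (q : Poly × Poly) (i : ℕ) : Poly :=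
  bif Nat.beq (i % 16) 0 then der^[i / 16] q.1
  else bif Nat.beq (i % 16) 1 then der^[i / 16] q.2
  else 0

/-- The variation along `q`. -/
noncomputable def vary (q : Poly × Poly) (p : Poly) : Poly := norm (derive (varyVar q) p)

noncomputable def dot (f g : Poly × Poly) : Poly := f.1 * g.1 + f.2 * g.2

noncomputable def ders (f : Poly × Poly) : Poly × Poly := (der f.1, der f.2)

/-- The part of the variation of `(a K + 3 c J) ξ` along `q`, with `ξ` fixed, that does not contain
a variation of the nonlocal variable; or the same for `η`. -/
noncomputable def hamVary (q : Poly × Poly) (k : ℕ) : Poly × Poly :=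
  ((rows (vary q) (arg k)).1 - ca * der q.1 * pot k,
    (rows (vary q) (arg k)).2 - ca * der q.2 * pot k)

/-- The density of `⟨η, H'[Q] ξ⟩`, where `H = a K + 3 c J`. -/
noncomputable def pairing : Poly :=
  dot (arg 1) (hamVary (X 6, X 7) 0) + ca * pot 1 * dot (ders (X 6, X 7)) (arg 0)

/-- The density of `⟨η, H'[Q] ξ⟩` after an integration by parts that leaves `Q` without
derivatives. -/
noncomputable def pairingReduced : Poly :=
  -- An entry `i` removes the variable `i + 16`, so this goes through the derivatives of Q from
  -- order four down to one. The highest come first, because each removal lowers the order by one.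
  (byParts [55, 54, 39, 38, 23, 22, 7, 6] (pairing, 0)).1

/-- The pair `M` with `⟨η, H'[Q] ξ⟩ = ⟨Q, M⟩`. -/
noncomputable def grad : Poly × Poly :=
  ((split 6 pairingReduced).1, (split 7 (split 6 pairingReduced).2).1)

/-- The coefficient of `D⁻¹ (u_x ζ₁ + v_x ζ₂)` in the Jacobi identity. -/
noncomputable def nonlocalPart : Poly :=
  norm (ca * (dot (ders (hamVal 0)) (arg 1) - dot (ders (hamVal 1)) (arg 0) - dot (U 1, V 1) grad))

/-- `byParts` strips derivatives from η but cannot remove the potential of η, which is not the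
derivative of another variable. The terms of `nonlocalPart` with this potential are a² (u_x ξ₁ + v_x
ξ₂)_x times it, so their primitive is supplied by hand. -/
noncomputable def primitivePart : Poly := ca * ca * dot (U 1, V 1) (arg 0) * pot 1

/-- The result of the integration of `nonlocalPart`, and its primitive. -/
noncomputable def nonlocalPrimitive : Poly × Poly :=
  -- The derivatives of η from order seven down to one. An expression linear in η and its
  -- derivatives, without potential of η, is exact precisely if nothing remains once they are
  -- removed.
  byParts [100, 101, 84, 85, 68, 69, 52, 53, 36, 37, 20, 21, 4, 5]
    (norm (nonlocalPart - der primitivePart), primitivePart)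

/-- The coefficients of `ζ₁` and `ζ₂` in the Jacobi identity. -/
noncomputable def localPart : Poly × Poly :=
  (norm ((hamVary (hamVal 0) 1).1 - (hamVary (hamVal 1) 0).1 - (rows id grad).1 -
      U 1 * nonlocalPrimitive.2),
    norm ((hamVary (hamVal 0) 1).2 - (hamVary (hamVal 1) 0).2 - (rows id grad).2 -
      V 1 * nonlocalPrimitive.2))

/-- The four entries say, in this order: the pairing is ⟨Q, M⟩ modulo total derivatives, with
nothing left over; N is a total derivative; the coefficient of ζ₁ vanishes; the coefficient of ζ₂
vanishes. -/
theorem jacobi_check :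
    (isNil (split 7 (split 6 pairingReduced).2).2 && isNil nonlocalPrimitive.1 &&
      isNil localPart.1 && isNil localPart.2) = true := by
  decide +kernel

/-- The indices of the variables that occur in the coefficients of `a K + 3 c J`. -/
def isCoeffVar (i : ℕ) : Bool := i == 10 || i == 11 || i % 16 == 0 || i % 16 == 1

theorem involves_coeffs :
    (coeffs₁.all (involves isCoeffVar) && coeffs₂.all (involves isCoeffVar) &&
      coeffs₄.all (involves isCoeffVar)) = true := by
  decide +kernel

end Poly


/-! ### The actions of operators on functions -/

section Action

variable {B : Type} [CommRing B] [Algebra ℝ B] (D : Derivation ℝ B B)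

/-- The value at `f` of the differential operator `L` whose coefficients are mapped to `B`
by `φ`. -/
noncomputable def opAct (φ : DiffPoly →ₗ[ℝ] B) (f : B) : LocalOp →ₗ[ℝ] B :=
  Finsupp.lsum ℝ fun n => LinearMap.mulRight ℝ (D^[n] f) ∘ₗ φ

theorem opAct_mono (φ : DiffPoly →ₗ[ℝ] B) (f : B) (n : ℕ) (a : DiffPoly) :
    opAct D φ f (mono n a) = φ a * D^[n] f := by
  simp [opAct, mono]

theorem opAct_eq_sum (φ : DiffPoly →ₗ[ℝ] B) (f : B) (L : LocalOp) :
    opAct D φ f L = L.sum fun n a => φ a * D^[n] f := by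
  simp only [opAct, Finsupp.lsum_apply]; rfl

variable {D} in
theorem opAct_compD {φ : DiffPoly →ₗ[ℝ] B} (hφ : ∀ a, φ (totalD a) = D (φ a)) (f : B)
    (L : LocalOp) : opAct D φ f (compD L) = D (opAct D φ f L) := by
  refine LinearMap.congr_fun (f := opAct D φ f ∘ₗ compD) (g := D.toLinearMap ∘ₗ opAct D φ f)
    (localOp_hom_ext fun n a => ?_) L
  simp [compD_mono, opAct_mono, hφ, Function.iterate_succ_apply']
  ring

variable {D} in
theorem opAct_localAdjoint_mono {φ : DiffPoly →ₗ[ℝ] B} (hφ : ∀ a, φ (totalD a) = D (φ a)) (f : B)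
    (n : ℕ) (a : DiffPoly) :
    opAct D φ f (localAdjoint (mono n a)) = (-1) ^ n * D^[n] (φ a * f) := by
  have h (k : ℕ) : opAct D φ f ((compD ^ k) (mono 0 a)) = D^[k] (φ a * f) := by
    induction k with
    | zero => simp [opAct_mono]
    | succ k ih =>
      rw [pow_succ', Module.End.mul_apply, opAct_compD hφ, ih, Function.iterate_succ_apply']
  rw [localAdjoint_mono, map_smul, h, Algebra.smul_def]
  simp

/-! ### Integration by parts modulo total derivatives. -/

/-- The total derivatives. -/
noncomputable def exact : Submodule ℝ B := LinearMap.range D.toLinearMap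

theorem apply_mem_exact (f : B) : D f ∈ exact D := ⟨f, rfl⟩

theorem mul_iterate_sub_mem_exact (f g : B) (n : ℕ) :
    g * D^[n] f - (-1) ^ n * D^[n] g * f ∈ exact D := by
  induction n generalizing g with
  | zero => simp
  | succ n ih =>
    have h := (exact D).add_mem (apply_mem_exact D (g * D^[n] f))
      ((exact D).neg_mem (ih (D g)))
    convert h using 1
    rw [Function.iterate_succ_apply', Function.iterate_succ_apply, D.leibniz, smul_eq_mul,
      smul_eq_mul]
    ring

variable {D} in
-- Integration by parts uses of the coefficients only that `φ` commutes with the derivations. Hence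
-- it applies both to an operator evaluated at w and to its directional derivative, although the
-- latter `φ` is not multiplicative.
theorem mul_opAct_sub_mem_exact {φ : DiffPoly →ₗ[ℝ] B} (hφ : ∀ a, φ (totalD a) = D (φ a))
    (f g : B) (L : LocalOp) :
    g * opAct D φ f L - f * opAct D φ g (localAdjoint L) ∈ exact D := by
  refine Finsupp.induction_linear L (by simp) (fun L M hL hM => ?_) fun n a => ?_
  · convert (exact D).add_mem hL hM using 1
    simp only [map_add]; ring
  · change g * opAct D φ f (mono n a) - f * opAct D φ g (localAdjoint (mono n a)) ∈ _
    rw [opAct_localAdjoint_mono hφ, opAct_mono]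
    convert mul_iterate_sub_mem_exact D f (φ a * g) n using 1
    ring

/-! ### Values and variations of differential polynomials -/

variable (w Q : Fin 2 → B)

theorem evalJet_u (n : ℕ) : evalJet D w (u n) = D^[n] (w 0) := by simp [evalJet, u]

theorem evalJet_v (n : ℕ) : evalJet D w (v n) = D^[n] (w 1) := by simp [evalJet, v]

theorem variation_u (n : ℕ) : variation D w Q (u n) = D^[n] (Q 0) := by simp [variation, u]

theorem variation_v (n : ℕ) : variation D w Q (v n) = D^[n] (Q 1) := by simp [variation, v]

theorem variation_X (p : Fin 2 × ℕ) :
    variation D w Q (MvPolynomial.X p) = D^[p.2] (Q p.1) := by simp [variation]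

theorem variation_C (r : ℝ) : variation D w Q (MvPolynomial.C r) = 0 := by
  simp only [variation, LinearMap.comp_apply, AlgHom.toLinearMap_apply, MvPolynomial.aeval_C]
  rfl

theorem fst_aeval_jet (a : DiffPoly) :
    ((MvPolynomial.aeval fun p =>
      (TrivSqZeroExt.inl (D^[p.2] (w p.1)) + TrivSqZeroExt.inr (D^[p.2] (Q p.1)) :
        TrivSqZeroExt B B) : DiffPoly →ₐ[ℝ] TrivSqZeroExt B B) a).fst = evalJet D w a := by
  refine DFunLike.congr_fun (F := DiffPoly →ₐ[ℝ] B)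
    (f := (TrivSqZeroExt.fstHom ℝ B B).comp (MvPolynomial.aeval _)) ?_ a
  ext p
  simp [evalJet]

/-- This is multiplication of dual numbers, read off in the coefficient of ε. -/
theorem variation_mul (a b : DiffPoly) : variation D w Q (a * b) =
    evalJet D w a * variation D w Q b + evalJet D w b * variation D w Q a := by
  rw [← fst_aeval_jet D w Q a, ← fst_aeval_jet D w Q b]
  change TrivSqZeroExt.snd (MvPolynomial.aeval _ (a * b)) = _
  rw [map_mul, TrivSqZeroExt.snd_mul, smul_eq_mul, op_smul_eq_smul, smul_eq_mul]
  rfl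

theorem totalD_X (p : Fin 2 × ℕ) : totalD (MvPolynomial.X p) = MvPolynomial.X (p.1, p.2 + 1) := by
  simp [totalD, MvPolynomial.mkDerivation_X]

theorem evalJet_totalD (a : DiffPoly) : evalJet D w (totalD a) = D (evalJet D w a) := by
  induction a using MvPolynomial.induction_on with
  | C r => simp [evalJet]
  | add a b ha hb => simp [ha, hb]
  | mul_X a p ha =>
    simp only [Derivation.leibniz, totalD_X, smul_eq_mul, map_add, map_mul, ha]
    simp [evalJet, Function.iterate_succ_apply']

theorem variation_totalD (a : DiffPoly) :
    variation D w Q (totalD a) = D (variation D w Q a) := by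
  induction a using MvPolynomial.induction_on with
  | C r => simp [variation_C]
  | add a b ha hb => simp [ha, hb]
  | mul_X a p ha =>
    simp only [Derivation.leibniz, totalD_X, smul_eq_mul, map_add, variation_mul, ha,
      variation_X, ← evalJet_totalD, Function.iterate_succ_apply']
    ring

end Action

/-! ### The operator `a K + b J` -/

/-- The `x`-derivatives of `u` and `v`. -/
noncomputable def jet₁ : Fin 2 → DiffPoly := ![u 1, v 1]

/-- The rank-one shape is what reduces the nonlocality to one potential for each argument. -/
theorem opK_nonlocal (i j : Fin 2) : (opK i j).2 = -(jet₁ i ⊗ₜ[ℝ] jet₁ j) := by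
  fin_cases i <;> fin_cases j <;>
    simp [opK, opK₁, opK₂, opK₃, opK₄, jet₁, ofLocal, dInv, scalarAdjoint]

theorem opJ_nonlocal (i j : Fin 2) : (opJ i j).2 = 0 := by
  fin_cases i <;> fin_cases j <;> rfl

theorem comb_nonlocal (a b : ℝ) (i j : Fin 2) :
    ((a • opK + b • opJ) i j).2 = -(a • (jet₁ i ⊗ₜ[ℝ] jet₁ j)) := by
  change a • (opK i j).2 + b • (opJ i j).2 = _
  rw [opK_nonlocal, opJ_nonlocal, smul_zero, add_zero, smul_neg]

section Formulas

variable {B : Type} [CommRing B] [Algebra ℝ B] (D : Derivation ℝ B B) (a b : ℝ)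
  (w Q ξ ζ : Fin 2 → B) (P R : Fin 2 → DiffPoly →ₗ[ℝ] B)

theorem applyOp_comb (i : Fin 2) :
    applyOp D (a • opK + b • opJ) w ξ P i =
      opAct D (evalJet D w).toLinearMap (ξ 0) ((a • opK + b • opJ) i 0).1 +
      opAct D (evalJet D w).toLinearMap (ξ 1) ((a • opK + b • opJ) i 1).1 -
      algebraMap ℝ B a * (D (w i) * (P 0 (u 1) + P 1 (v 1))) := by
  have h : evalJet D w (jet₁ i) = D (w i) := by
    fin_cases i
    · exact evalJet_u D w 1
    · exact evalJet_v D w 1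
  simp only [applyOp, Fin.sum_univ_two, opAct_eq_sum, comb_nonlocal, map_neg, map_smul,
    TensorProduct.map_tmul, LinearMap.mul'_apply, AlgHom.toLinearMap_apply, h]
  simp only [Algebra.smul_def, jet₁, Matrix.cons_val_zero, Matrix.cons_val_one]
  ring

theorem variation_jet₁ (i : Fin 2) : variation D w Q (jet₁ i) = D (Q i) := by
  fin_cases i
  · exact variation_u D w Q 1
  · exact variation_v D w Q 1

theorem derivPairing_comb :
    derivPairing D (a • opK + b • opJ) w Q ξ P ζ R =
      ξ 0 * (opAct D (variation D w Q) (ζ 0) ((a • opK + b • opJ) 0 0).1 +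
        opAct D (variation D w Q) (ζ 1) ((a • opK + b • opJ) 0 1).1) +
      ξ 1 * (opAct D (variation D w Q) (ζ 0) ((a • opK + b • opJ) 1 0).1 +
        opAct D (variation D w Q) (ζ 1) ((a • opK + b • opJ) 1 1).1) -
      algebraMap ℝ B a * ((ξ 0 * D (Q 0) + ξ 1 * D (Q 1)) * (R 0 (u 1) + R 1 (v 1))) +
      algebraMap ℝ B a * ((ζ 0 * D (Q 0) + ζ 1 * D (Q 1)) * (P 0 (u 1) + P 1 (v 1))) := by
  simp only [derivPairing, Fin.sum_univ_two, opAct_eq_sum, comb_nonlocal, map_neg, map_smul,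
    TensorProduct.map_tmul, LinearMap.mul'_apply, variation_jet₁, mul_assoc, ← Finsupp.mul_sum]
  simp only [Algebra.smul_def, jet₁, Matrix.cons_val_zero, Matrix.cons_val_one]
  ring

variable {D} in
/-- The local part of `a K + b J` is skew-adjoint. -/
theorem skew_mem_exact {φ : DiffPoly →ₗ[ℝ] B} (hφ : ∀ p, φ (totalD p) = D (φ p)) (f g : Fin 2 → B) :
    g 0 * (opAct D φ (f 0) ((a • opK + b • opJ) 0 0).1 +
        opAct D φ (f 1) ((a • opK + b • opJ) 0 1).1) +
      g 1 * (opAct D φ (f 0) ((a • opK + b • opJ) 1 0).1 +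
        opAct D φ (f 1) ((a • opK + b • opJ) 1 1).1) +
      (f 0 * (opAct D φ (g 0) ((a • opK + b • opJ) 0 0).1 +
        opAct D φ (g 1) ((a • opK + b • opJ) 0 1).1) +
      f 1 * (opAct D φ (g 0) ((a • opK + b • opJ) 1 0).1 +
        opAct D φ (g 1) ((a • opK + b • opJ) 1 1).1)) ∈ exact D := by
  have hadj (i j : Fin 2) : localAdjoint ((a • opK + b • opJ) i j).1 =
      -((a • opK + b • opJ) j i).1 :=
    congr_arg Prod.fst (congr_fun (congr_fun
      (adjoint_smul_add_smul adjoint_opK adjoint_opJ a b) j) i)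
  have h (i j : Fin 2) := mul_opAct_sub_mem_exact hφ (f j) (g i) ((a • opK + b • opJ) i j).1
  simp only [hadj, map_neg] at h
  convert (exact D).add_mem ((exact D).add_mem (h 0 0) (h 0 1))
    ((exact D).add_mem (h 1 0) (h 1 1)) using 1
  ring

end Formulas


/-! ### The computable model computes the operators -/

namespace Poly

/-- The differential operator with the coefficients `L`, times `Dⁿ`. -/
noncomputable def toOp (x : ℕ → DiffPoly) : ℕ → List Poly → LocalOp
  | _, [] => 0
  | n, p :: L => mono n (ev x p) + toOp x (n + 1) L

/-- The differential polynomials that the variables of the coefficients stand for. -/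
noncomputable def coeffVal (a c : ℝ) (i : ℕ) : DiffPoly :=
  if i = 10 then MvPolynomial.C a else if i = 11 then MvPolynomial.C c
  else if i % 16 = 0 then u (i / 16) else v (i / 16)

section

variable (a c : ℝ)

theorem coeffVal_u (n : ℕ) : coeffVal a c (16 * n) = u n := by
  simp [coeffVal, show 16 * n ≠ 10 by omega, show 16 * n ≠ 11 by omega]

theorem coeffVal_v (n : ℕ) : coeffVal a c (16 * n + 1) = v n := by
  simp [coeffVal, show 16 * n ≠ 9 by omega, show 16 * n ≠ 10 by omega,
    show (16 * n + 1) % 16 = 1 by omega, show (16 * n + 1) / 16 = n by omega]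

@[simp] theorem ev_coeffVal_U (n : ℕ) : ev (coeffVal a c) (U n) = u n := by
  rw [U, ev_X, coeffVal_u]

@[simp] theorem ev_coeffVal_V (n : ℕ) : ev (coeffVal a c) (V n) = v n := by
  rw [V, ev_X, coeffVal_v]

@[simp] theorem ev_coeffVal_ca : ev (coeffVal a c) ca = MvPolynomial.C a := by
  simp [ca, coeffVal]

@[simp] theorem ev_coeffVal_cc : ev (coeffVal a c) cc = MvPolynomial.C c := by
  simp [cc, coeffVal]

theorem C_two : (MvPolynomial.C 2 : DiffPoly) = 2 := map_ofNat MvPolynomial.C 2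

theorem C_three : (MvPolynomial.C 3 : DiffPoly) = 3 := map_ofNat MvPolynomial.C 3

theorem toOp_coeffs₁ :
    ((a • opK + (3 * c) • opJ) 0 0).1 = toOp (coeffVal a c) 0 coeffs₁ := by
  change a • (opK 0 0).1 + (3 * c) • (opJ 0 0).1 = _
  ext1 n
  -- Needed for the coefficient of D, where 3c meets the -1/3 of J.
  have h : (3 : DiffPoly) * MvPolynomial.C 3⁻¹ = 1 := by
    rw [← C_three, ← MvPolynomial.C_mul, mul_inv_cancel₀ three_ne_zero, MvPolynomial.C_1]
  rcases n with _ | _ | _ | _ | n <;>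
  simp [opK, opK₁, opJ, ofLocal, dInv, toOp, coeffs₁, mono, MvPolynomial.smul_eq_C_mul,
    C_three] <;> first | ring1 | linear_combination -MvPolynomial.C c * h

theorem toOp_coeffs₂ :
    ((a • opK + (3 * c) • opJ) 0 1).1 = toOp (coeffVal a c) 0 coeffs₂ := by
  change a • (opK 0 1).1 + (3 * c) • (opJ 0 1).1 = _
  ext1 n
  rcases n with _ | _ | _ | _ | _ | n <;>
  simp [opK, opK₂, opJ, ofLocal, dInv, toOp, coeffs₂, compD_mono, totalD_u] <;>
  simp [mono, MvPolynomial.smul_eq_C_mul, C_two, C_three] <;> ring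

theorem toOp_coeffs₄ :
    ((a • opK + (3 * c) • opJ) 1 1).1 = toOp (coeffVal a c) 0 coeffs₄ := by
  change a • (opK 1 1).1 + (3 * c) • (opJ 1 1).1 = _
  ext1 n
  rcases n with _ | _ | _ | _ | n <;>
  simp [opK, opK₄, opJ, ofLocal, dInv, toOp, coeffs₄, mono, MvPolynomial.smul_eq_C_mul,
    C_three] <;> ring

/-- The local part of this entry is never expanded; the model computes its values through `adj` from
the coefficients of the transposed entry. -/
theorem comb_one_zero (b : ℝ) :
    ((a • opK + b • opJ) 1 0).1 = -localAdjoint ((a • opK + b • opJ) 0 1).1 := by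
  have h : localAdjoint ((a • opK + b • opJ) 0 1).1 = -((a • opK + b • opJ) 1 0).1 :=
    congr_arg Prod.fst (congr_fun (congr_fun
      (adjoint_smul_add_smul adjoint_opK adjoint_opJ a b) 1) 0)
  rw [h, neg_neg]

end

section Jets

variable {B : Type} [CommRing B] [Algebra ℝ B] {D : Derivation ℝ B B} {y : ℕ → B}

theorem involves_true (p : Poly) : p.involves (fun _ => true) = true := by
  induction p with
  | nil => rfl
  | cons m c p ih => simp [involves, ih]

theorem ev_der (hy : ∀ i, D (y i) = ev y (dVar i)) (p : Poly) : ev y (der p) = D (ev y p) := by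
  rw [der, ev_norm]
  exact (map_ev_derive (s := fun _ => true) (RingHom.id B) D.toLinearMap.toAddMonoidHom
    (fun f g => D.leibniz f g) (fun _ _ => rfl) dVar (fun i _ => hy i) (involves_true p)).symm

theorem ev_iterate_der (hy : ∀ i, D (y i) = ev y (dVar i)) (n : ℕ) (p : Poly) :
    ev y (der^[n] p) = D^[n] (ev y p) := by
  induction n with
  | zero => rfl
  | succ n ih => rw [Function.iterate_succ_apply', Function.iterate_succ_apply', ev_der hy, ih]

/-- Each step replaces y_{i+16} q by D(y_i q) - y_i Dq, so the first value plus the derivative of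
the second is invariant. -/
theorem ev_byParts (hy : ∀ i, D (y i) = ev y (dVar i)) {l : List ℕ}
    (hl : ∀ i ∈ l, D (y i) = y (i + 16)) (p : Poly × Poly) :
    ev y (byParts l p).1 + D (ev y (byParts l p).2) = ev y p.1 + D (ev y p.2) := by
  induction l generalizing p with
  | nil => simp [byParts]
  | cons i l ih =>
    rw [byParts, ih fun j hj => hl j (List.mem_cons_of_mem _ hj)]
    simp only [ev_sub, ev_add, ev_mul, ev_X, ev_der hy, map_add, D.leibniz, smul_eq_mul,
      hl i List.mem_cons_self, ← ev_split y (i + 16) p.1]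
    ring

variable {x : ℕ → DiffPoly} {φ : DiffPoly →ₗ[ℝ] B} {ψ : Poly → Poly}

theorem opAct_toOp (hy : ∀ i, D (y i) = ev y (dVar i)) {L : List Poly}
    (hL : ∀ p ∈ L, φ (ev x p) = ev y (ψ p)) (n : ℕ) (f : B) (g : Poly)
    (hf : D^[n] f = ev y g) :
    opAct D φ f (toOp x n L) = ev y (act (L.map ψ) g) := by
  induction L generalizing n g with
  | nil => simp [toOp, act]
  | cons p L ih =>
    have hg : D^[n + 1] f = ev y (der g) := by
      rw [Function.iterate_succ_apply', hf, ev_der hy]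
    rw [toOp, map_add, opAct_mono, hf, hL p List.mem_cons_self,
      ih (fun q hq => hL q (List.mem_cons_of_mem _ hq)) _ _ hg]
    simp [act]

theorem opAct_localAdjoint_toOp (hy : ∀ i, D (y i) = ev y (dVar i))
    (hφ : ∀ a, φ (totalD a) = D (φ a)) {L : List Poly}
    (hL : ∀ p ∈ L, φ (ev x p) = ev y (ψ p)) (n : ℕ) (g : Poly) :
    opAct D φ (ev y g) (localAdjoint (toOp x n L)) =
      (-1) ^ n * D^[n] (ev y (adj (L.map ψ) g)) := by
  induction L generalizing n with
  | nil => simp [toOp, adj, iterate_map_zero]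
  | cons p L ih =>
    rw [toOp, map_add, map_add, opAct_localAdjoint_mono hφ, hL p List.mem_cons_self,
      ih fun q hq => hL q (List.mem_cons_of_mem _ hq)]
    simp only [List.map_cons, adj, ev_sub, ev_mul, ev_der hy, iterate_map_sub,
      Function.iterate_succ_apply]
    ring

/-- `φ` maps the coefficients of `a K + 3 c J` to the values of their images under `ψ`. -/
theorem opAct_rows (a c : ℝ) (hy : ∀ i, D (y i) = ev y (dVar i))
    (hφ : ∀ a, φ (totalD a) = D (φ a))
    (hψ : ∀ p : Poly, p.involves isCoeffVar = true → φ (ev (coeffVal a c) p) = ev y (ψ p))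
    (f : Poly × Poly) :
    opAct D φ (ev y f.1) ((a • opK + (3 * c) • opJ) 0 0).1 +
        opAct D φ (ev y f.2) ((a • opK + (3 * c) • opJ) 0 1).1 = ev y (rows ψ f).1 ∧
      opAct D φ (ev y f.1) ((a • opK + (3 * c) • opJ) 1 0).1 +
        opAct D φ (ev y f.2) ((a • opK + (3 * c) • opJ) 1 1).1 = ev y (rows ψ f).2 := by
  have h := involves_coeffs
  simp only [Bool.and_eq_true, List.all_eq_true] at h
  obtain ⟨⟨h₁, h₂⟩, h₄⟩ := h
  rw [comb_one_zero, toOp_coeffs₁, toOp_coeffs₂, toOp_coeffs₄, map_neg,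
    opAct_toOp hy (fun p hp => hψ p (h₁ p hp)) 0 _ f.1 rfl,
    opAct_toOp hy (fun p hp => hψ p (h₂ p hp)) 0 _ f.2 rfl,
    opAct_toOp hy (fun p hp => hψ p (h₄ p hp)) 0 _ f.2 rfl,
    opAct_localAdjoint_toOp hy hφ fun p hp => hψ p (h₂ p hp)]
  simp [rows, sub_eq_neg_add]

end Jets

end Poly


open BurgersSystem.Poly

/-! ### The Jacobi identity -/

section Jacobi

variable {B : Type} [CommRing B] [Algebra ℝ B] (D : Derivation ℝ B B) (w : Fin 2 → B)
  (ξ : Fin 3 → Fin 2 → B) (P : Fin 3 → Fin 2 → DiffPoly →ₗ[ℝ] B) (a c : ℝ)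

/-- The function `D⁻¹ (u_x ξ₁ + v_x ξ₂)`. -/
noncomputable def potential (P : Fin 2 → DiffPoly →ₗ[ℝ] B) : B := P 0 (u 1) + P 1 (v 1)

variable {D w} in
theorem apply_potential {ξ : Fin 2 → B} {P : Fin 2 → DiffPoly →ₗ[ℝ] B}
    (hP : IsAntiderivative D w ξ P) : D (potential P) = D (w 0) * ξ 0 + D (w 1) * ξ 1 := by
  rw [potential, map_add, hP, hP, evalJet_u, evalJet_v]
  rfl

/-- The functions that the variables of the computable model stand for. -/
noncomputable def jetBase (Q : Fin 2 → B) : ℕ → B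
  | 0 => w 0
  | 1 => w 1
  | 2 => ξ 0 0
  | 3 => ξ 0 1
  | 4 => ξ 1 0
  | 5 => ξ 1 1
  | 6 => Q 0
  | 7 => Q 1
  | 8 => potential (P 0)
  | 9 => potential (P 1)
  | 10 => algebraMap ℝ B a
  | 11 => algebraMap ℝ B c
  | _ => 0

/-- The values of the variables of the computable model. -/
noncomputable def jetVal (Q : Fin 2 → B) (i : ℕ) : B := D^[i / 16] (jetBase w ξ P a c Q (i % 16))

variable (Q : Fin 2 → B)

theorem apply_jetVal (i : ℕ) :
    D (jetVal D w ξ P a c Q i) = jetVal D w ξ P a c Q (i + 16) := by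
  rw [jetVal, jetVal, Nat.add_mod_right, Nat.add_div_right i (by norm_num : 0 < 16),
    Function.iterate_succ_apply']

theorem jetVal_u (n : ℕ) : jetVal D w ξ P a c Q (16 * n) = D^[n] (w 0) := by
  rw [jetVal, Nat.mul_mod_right, Nat.mul_div_cancel_left n (by norm_num : 0 < 16)]
  rfl

theorem jetVal_v (n : ℕ) : jetVal D w ξ P a c Q (16 * n + 1) = D^[n] (w 1) := by
  rw [jetVal, show (16 * n + 1) % 16 = 1 by omega, show (16 * n + 1) / 16 = n by omega]
  rfl

variable {D w ξ P} in
-- The antiderivative property enters through the variables 8 and 9; the variables 10 and 11 are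
-- constants.
theorem jetVal_dVar (hP : ∀ k, IsAntiderivative D w (ξ k) (P k)) (i : ℕ) :
    D (jetVal D w ξ P a c Q i) = ev (jetVal D w ξ P a c Q) (dVar i) := by
  by_cases h : 8 ≤ i ∧ i ≤ 11
  · obtain ⟨h₁, h₂⟩ := h
    interval_cases i
    · change D (potential (P 0)) = _
      rw [apply_potential (hP 0),
        show dVar 8 = cons [2, 16] 1 (cons [3, 17] 1 nil) from rfl]
      simp [ev, evMono, jetVal, jetBase]
      ring
    · change D (potential (P 1)) = _
      rw [apply_potential (hP 1),
        show dVar 9 = cons [4, 16] 1 (cons [5, 17] 1 nil) from rfl]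
      simp [ev, evMono, jetVal, jetBase]
      ring
    · exact D.map_algebraMap a
    · exact D.map_algebraMap c
  · have hi : (Nat.ble 8 i && Nat.ble i 11) = false := by
      rw [Bool.eq_false_iff, Ne, Bool.and_eq_true, Nat.ble_eq, Nat.ble_eq]
      exact h
    rw [dVar, hi, cond_false, ev_X, apply_jetVal]

theorem evalJet_coeffVal {i : ℕ} (hi : isCoeffVar i = true) :
    evalJet D w (coeffVal a c i) = jetVal D w ξ P a c Q i := by
  have h : i = 10 ∨ i = 11 ∨ i = 16 * (i / 16) ∨ i = 16 * (i / 16) + 1 := by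
    simp only [isCoeffVar, Bool.or_eq_true, beq_iff_eq] at hi
    omega
  rcases h with h | h | h | h
  · subst h; simp [coeffVal, evalJet]; rfl
  · subst h; simp [coeffVal, evalJet]; rfl
  · rw [h, coeffVal_u, evalJet_u, jetVal_u]
  · rw [h, coeffVal_v, evalJet_v, jetVal_v]

theorem evalJet_ev {p : Poly} (hp : p.involves isCoeffVar = true) :
    evalJet D w (ev (coeffVal a c) p) = ev (jetVal D w ξ P a c Q) p :=
  map_ev (evalJet D w).toRingHom (fun _ hi => evalJet_coeffVal D w ξ P a c Q hi) hp

variable {D w ξ P} in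
theorem variation_ev (hP : ∀ k, IsAntiderivative D w (ξ k) (P k)) {q : Poly × Poly} {G : Fin 2 → B}
    (h₀ : G 0 = ev (jetVal D w ξ P a c Q) q.1) (h₁ : G 1 = ev (jetVal D w ξ P a c Q) q.2)
    {p : Poly} (hp : p.involves isCoeffVar = true) :
    variation D w G (ev (coeffVal a c) p) = ev (jetVal D w ξ P a c Q) (vary q p) := by
  have hy := jetVal_dVar a c Q hP
  rw [vary, ev_norm]
  refine map_ev_derive (evalJet D w).toRingHom (variation D w G).toAddMonoidHom
    (variation_mul D w G) (fun _ hi => evalJet_coeffVal D w ξ P a c Q hi) (varyVar q)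
    (fun i hi => ?_) hp
  have h : i = 10 ∨ i = 11 ∨ i = 16 * (i / 16) ∨ i = 16 * (i / 16) + 1 := by
    simp only [isCoeffVar, Bool.or_eq_true, beq_iff_eq] at hi
    omega
  change variation D w G (coeffVal a c i) = _
  rcases h with h | h | h | h
  · subst h; simp [coeffVal, variation_C]; rfl
  · subst h; simp [coeffVal, variation_C]; rfl
  · have hv : varyVar q (16 * (i / 16)) = der^[i / 16] q.1 := by
      rw [varyVar, Nat.mul_mod_right, Nat.mul_div_cancel_left _ (by norm_num : 0 < 16)]
      rfl
    rw [h, coeffVal_u, variation_u, hv, ev_iterate_der hy, h₀]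
  · have hv : varyVar q (16 * (i / 16) + 1) = der^[i / 16] q.2 := by
      rw [varyVar, show (16 * (i / 16) + 1) % 16 = 1 by omega,
        show (16 * (i / 16) + 1) / 16 = i / 16 by omega]
      rfl
    rw [h, coeffVal_v, variation_v, hv, ev_iterate_der hy, h₁]

end Jacobi

theorem jacobiIdentity_comb (a c : ℝ) : JacobiIdentity (a • opK + (3 * c) • opJ) := by
  intro B _ _ D w ξ P hP
  -- ζ = `ξ 2` has no variable in the model: it is represented only by Q = Hζ, which the model
  -- treats as an arbitrary pair.
  set Q := applyOp D (a • opK + (3 * c) • opJ) w (ξ 2) (P 2) with hQ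
  set y := jetVal D w ξ P a c Q with hy_def
  have hy : ∀ i, D (y i) = ev y (dVar i) := jetVal_dVar a c Q hP
  have hu : y 16 = D (w 0) := jetVal_u D w ξ P a c Q 1
  have hv : y 17 = D (w 1) := jetVal_v D w ξ P a c Q 1
  have hφ : ∀ p, (evalJet D w).toLinearMap (totalD p) = D ((evalJet D w).toLinearMap p) :=
    evalJet_totalD D w
  have hrows := opAct_rows a c (ψ := id) hy hφ fun p hp => evalJet_ev D w ξ P a c Q hp
  have hham (k : ℕ) (l : Fin 3) (h₂ : ev y (arg k).1 = ξ l 0) (h₃ : ev y (arg k).2 = ξ l 1)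
      (hp : ev y (pot k) = potential (P l)) :
      applyOp D (a • opK + (3 * c) • opJ) w (ξ l) (P l) 0 = ev y (hamVal k).1 ∧
        applyOp D (a • opK + (3 * c) • opJ) w (ξ l) (P l) 1 = ev y (hamVal k).2 := by
    have h := hrows (arg k)
    rw [h₂, h₃] at h
    constructor
    · rw [applyOp_comb, h.1]
      simp only [hamVal, ev_norm, ev_sub, ev_mul, hp, U, ca, ev_X, potential, mul_one, hu]
      rw [mul_assoc]
      rfl
    · rw [applyOp_comb, h.2]
      simp only [hamVal, ev_norm, ev_sub, ev_mul, hp, V, ca, ev_X, potential, mul_one, hv]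
      rw [mul_assoc]
      rfl
  have ha0 : ev y (arg 0).1 = ξ 0 0 := ev_X y 2
  have ha1 : ev y (arg 0).2 = ξ 0 1 := ev_X y 3
  have hb0 : ev y (arg 1).1 = ξ 1 0 := ev_X y 4
  have hb1 : ev y (arg 1).2 = ξ 1 1 := ev_X y 5
  have hp0 : ev y (pot 0) = potential (P 0) := ev_X y 8
  have hp1 : ev y (pot 1) = potential (P 1) := ev_X y 9
  have hq0 : ev y (X 6) = Q 0 := ev_X y 6
  have hq1 : ev y (X 7) = Q 1 := ev_X y 7
  have hca : ev y ca = algebraMap ℝ B a := ev_X y 10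
  have hU : ev y (U 1) = D (w 0) := (ev_X y 16).trans hu
  have hV : ev y (V 1) = D (w 1) := (ev_X y 17).trans hv
  obtain ⟨hA0, hA1⟩ := hham 0 0 ha0 ha1 hp0
  obtain ⟨hB0, hB1⟩ := hham 1 1 hb0 hb1 hp1
  set GA := applyOp D (a • opK + (3 * c) • opJ) w (ξ 0) (P 0) with hGA
  set GB := applyOp D (a • opK + (3 * c) • opJ) w (ξ 1) (P 1) with hGB
  -- Used for the three directions Hξ, Hη and Q.
  have hvar {G : Fin 2 → B} {q : Poly × Poly} (h₀ : G 0 = ev y q.1) (h₁ : G 1 = ev y q.2) :=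
    opAct_rows a c (ψ := vary q) hy (variation_totalD D w G)
      fun p hp => variation_ev a c Q hP h₀ h₁ hp
  have hrA := hvar hA0 hA1 (arg 1)
  have hrB := hvar hB0 hB1 (arg 0)
  have hrQ := hvar (q := (X 6, X 7)) hq0.symm hq1.symm (arg 0)
  have hrM := hrows grad
  rw [hb0, hb1] at hrA
  rw [ha0, ha1] at hrB hrQ
  have hcheck := jacobi_check
  simp only [Bool.and_eq_true] at hcheck
  obtain ⟨⟨⟨hc₁, hc₂⟩, hc₃⟩, hc₄⟩ := hcheck
  have hparts (l : List ℕ) := ev_byParts hy (l := l) fun i _ => apply_jetVal D w ξ P a c Q i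
  -- the pairing with `Q`
  have hred : ev y pairing - (Q 0 * ev y grad.1 + Q 1 * ev y grad.2) ∈ exact D := by
    have h₁ := hparts [55, 54, 39, 38, 23, 22, 7, 6] (pairing, 0)
    have h₂ := ev_split y 6 pairingReduced
    have h₃ := ev_split y 7 (split 6 pairingReduced).2
    rw [eq_zero_of_isNil hc₁, ev_zero, add_zero] at h₃
    refine ⟨ev y (byParts [55, 54, 39, 38, 23, 22, 7, 6] (pairing, 0)).2, ?_⟩
    change D _ = _
    change ev y pairingReduced + _ = ev y pairing + D (ev y 0) at h₁
    rw [ev_zero, map_zero] at h₁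
    rw [← ev_X y 6, hq0] at h₂
    rw [← ev_X y 7, hq1] at h₃
    change _ = ev y pairing - (Q 0 * ev y (split 6 pairingReduced).1 +
      Q 1 * ev y (split 7 (split 6 pairingReduced).2).1)
    linear_combination h₁ + h₂ + h₃
  -- N = DE.
  have hE : D (ev y nonlocalPrimitive.2) = ev y nonlocalPart := by
    have h := hparts [100, 101, 84, 85, 68, 69, 52, 53, 36, 37, 20, 21, 4, 5]
      (norm (nonlocalPart - der primitivePart), primitivePart)
    change ev y nonlocalPrimitive.1 + D (ev y nonlocalPrimitive.2) = _ at h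
    rw [eq_zero_of_isNil hc₂, ev_zero, zero_add] at h
    simpa [ev_der hy] using h
  have hL0 : ev y localPart.1 = 0 := by rw [eq_zero_of_isNil hc₃, ev_zero]
  have hL1 : ev y localPart.2 = 0 := by rw [eq_zero_of_isNil hc₄, ev_zero]
  simp only [localPart, hamVary, ev_norm, ev_sub, ev_mul, ev_der hy, hU, hV, hca, hp0, hp1,
    ← hA0, ← hA1, ← hB0, ← hB1, ← hrA.1, ← hrA.2, ← hrB.1, ← hrB.2, ← hrM.1, ← hrM.2]
    at hL0 hL1
  simp only [nonlocalPart, dot, ders, ev_norm, ev_sub, ev_add, ev_mul, ev_der hy, hU, hV, hca,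
    ha0, ha1, hb0, hb1, ← hA0, ← hA1, ← hB0, ← hB1] at hE
  simp only [pairing, dot, ders, hamVary, ev_sub, ev_add, ev_mul, ev_der hy, hca, hp0, hp1,
    ha0, ha1, hb0, hb1, hq0, hq1, ← hrQ.1, ← hrQ.2] at hred
  -- Skewness of the local part is used twice: for H'[Hη] between ξ and ζ, and for H itself between
  -- M and ζ.
  have hskewB := skew_mem_exact a (3 * c) (variation_totalD D w GB) (ξ 2) (ξ 0)
  have hskewM := skew_mem_exact a (3 * c) hφ (ξ 2) ![ev y grad.1, ev y grad.2]
  -- D(θE) = θN + E(u_x ζ₁ + v_x ζ₂) removes the potential of ζ.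
  have hpot := apply_mem_exact D (potential (P 2) * ev y nonlocalPrimitive.2)
  have hQ0 : Q 0 = _ := applyOp_comb D a (3 * c) w (ξ 2) (P 2) 0
  have hQ1 : Q 1 = _ := applyOp_comb D a (3 * c) w (ξ 2) (P 2) 1
  rw [← potential] at hQ0 hQ1
  rw [D.leibniz, smul_eq_mul, smul_eq_mul, hE, apply_potential (hP 2)] at hpot
  simp only [Matrix.cons_val_zero, Matrix.cons_val_one] at hskewM
  have hmem := (exact D).add_mem ((exact D).add_mem hred hskewB)
    ((exact D).add_mem hskewM hpot)
  suffices h : ∑ k : Fin 3, derivPairing D (a • opK + (3 * c) • opJ) w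
      (applyOp D (a • opK + (3 * c) • opJ) w (ξ (k + 1)) (P (k + 1)))
        (ξ k) (P k) (ξ (k + 2)) (P (k + 2)) ∈ exact D from h
  rw [Fin.sum_univ_three]
  change derivPairing D _ w GB (ξ 0) (P 0) (ξ 2) (P 2) +
    derivPairing D _ w Q (ξ 1) (P 1) (ξ 0) (P 0) +
    derivPairing D _ w GA (ξ 2) (P 2) (ξ 1) (P 1) ∈ _
  convert hmem using 1
  have hpot_eq (k) : P k 0 (u 1) + P k 1 (v 1) = potential (P k) := rfl
  simp only [derivPairing_comb, hpot_eq]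
  -- The Jacobi sum differs from the collected total derivatives by ζ₁ and ζ₂ times vanishing
  -- coefficients, once ⟨Q, M⟩ is expanded with Q = Hζ.
  linear_combination ξ 2 0 * hL0 + ξ 2 1 * hL1 + ev y grad.1 * hQ0 + ev y grad.2 * hQ1


/-! ### The Hamiltonian functionals -/

/-- Terms of orders that do not occur vanish, so a bound on the order replaces the exact set of
variables. -/
theorem varDeriv_eq_sum_range {h : DiffPoly} {N : ℕ}
    (hN : h ∈ MvPolynomial.supported ℝ {p : Fin 2 × ℕ | p.2 < N}) (i : Fin 2) :
    varDeriv h i = ∑ n ∈ Finset.range N, (-1) ^ n * totalD^[n] (MvPolynomial.pderiv (i, n) h) := by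
  rw [MvPolynomial.mem_supported] at hN
  refine Finset.sum_subset (fun n hn => ?_) fun n _ hn => ?_
  · obtain ⟨p, hp, rfl⟩ := Finset.mem_image.1 hn
    exact Finset.mem_range.2 (hN hp)
  · rw [MvPolynomial.pderiv_eq_zero_of_notMem_vars fun h' =>
      hn (Finset.mem_image.2 ⟨_, h', rfl⟩), iterate_map_zero, mul_zero]

theorem u_mem_supported {n N : ℕ} (h : n < N) :
    u n ∈ MvPolynomial.supported ℝ {p : Fin 2 × ℕ | p.2 < N} :=
  MvPolynomial.X_mem_supported.2 h

theorem v_mem_supported {n N : ℕ} (h : n < N) :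
    v n ∈ MvPolynomial.supported ℝ {p : Fin 2 × ℕ | p.2 < N} :=
  MvPolynomial.X_mem_supported.2 h

theorem pderiv_u (i : Fin 2) (m n : ℕ) :
    MvPolynomial.pderiv (i, m) (u n) = if i = 0 ∧ m = n then 1 else 0 := by
  rw [u, MvPolynomial.pderiv_X, Pi.single_apply]
  simp [Prod.ext_iff, eq_comm]

theorem pderiv_v (i : Fin 2) (m n : ℕ) :
    MvPolynomial.pderiv (i, m) (v n) = if i = 1 ∧ m = n then 1 else 0 := by
  rw [v, MvPolynomial.pderiv_X, Pi.single_apply]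
  simp [Prod.ext_iff, eq_comm]

theorem varDeriv_h₀ : varDeriv h₀ = ![0, algebraMap ℝ DiffPoly (1 / 2)] := by
  have h : h₀ ∈ MvPolynomial.supported ℝ {p : Fin 2 × ℕ | p.2 < 1} :=
    Subalgebra.smul_mem _ (v_mem_supported one_pos) _
  ext1 i
  rw [varDeriv_eq_sum_range h]
  fin_cases i <;> simp [h₀, pderiv_v, Algebra.smul_def]

theorem varDeriv_h₁ : varDeriv h₁ =
    ![u 0 * v 0 - v 1, u 1 + (1 / 2 : ℝ) • u 0 ^ 2 + (2 / 3 : ℝ) • v 0] := by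
  have hu {n : ℕ} (hn : n < 2) := u_mem_supported hn
  have hv := v_mem_supported (show 0 < 2 by norm_num)
  have h : h₁ ∈ MvPolynomial.supported ℝ {p : Fin 2 × ℕ | p.2 < 2} :=
    add_mem (add_mem (mul_mem hv (hu one_lt_two))
      (Subalgebra.smul_mem _ (mul_mem (pow_mem (hu two_pos) 2) hv) _))
      (Subalgebra.smul_mem _ (pow_mem hv 2) _)
  ext1 i
  rw [varDeriv_eq_sum_range h]
  fin_cases i
  · simp [h₁, pderiv_v, pderiv_u, Finset.sum_range_succ, Derivation.leibniz, Derivation.leibniz_pow,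
      totalD_v]
    algebra
  · simp [h₁, pderiv_v, pderiv_u, Finset.sum_range_succ, Derivation.leibniz, Derivation.leibniz_pow]
    algebra

/-! ### The two Hamiltonian forms of the system. -/

theorem localApply_mono (n : ℕ) (a f : DiffPoly) : localApply (mono n a) f = a * totalD^[n] f :=
  Finsupp.sum_single_index (zero_mul _)

theorem localApply_add (L M : LocalOp) (f : DiffPoly) :
    localApply (L + M) f = localApply L f + localApply M f :=
  Finsupp.sum_add_index' (fun _ => zero_mul _) fun _ _ _ => add_mul _ _ _

theorem localApply_neg (L : LocalOp) (f : DiffPoly) : localApply (-L) f = -localApply L f := by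
  rw [localApply, Finsupp.sum_neg_index fun _ => zero_mul _]
  simp [localApply, Finsupp.sum]

theorem localApply_smul (c : ℝ) (L : LocalOp) (f : DiffPoly) :
    localApply (c • L) f = c • localApply L f := by
  rw [localApply, Finsupp.sum_smul_index' fun _ => zero_mul _]
  simp [localApply, Finsupp.sum, Finset.smul_sum]

/-- Since δ_u ∫ v/2 dx = 0, this discards the first column of K, and with it the unexpanded adjoint
K₃. -/
theorem localApply_zero_right (L : LocalOp) : localApply L 0 = 0 := by
  simp [localApply, Finsupp.sum]

theorem hasValue_opK : HasValue opK (varDeriv h₀) rhs := by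
  rw [varDeriv_h₀]
  -- Row by row, -u_x D⁻¹(v_x/2) and -v_x D⁻¹(v_x/2), with D⁻¹(v_x/2) = v/2.
  refine ⟨![-(u 1 ⊗ₜ ((1 / 2 : ℝ) • v 0)), -(v 1 ⊗ₜ ((1 / 2 : ℝ) • v 0))], fun i => ?_⟩
  fin_cases i
  · refine ⟨?_, ?_, ?_⟩
    · simp [opK, opK₁, opK₂, ofLocal, dInv, totalD_v, Algebra.smul_def, mul_comm]
    · simp [v]
    · simp [opK, opK₁, opK₂, ofLocal, dInv, rhs, localApply_add, localApply_mono,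
        localApply_zero_right]
      simp only [← MvPolynomial.algebraMap_eq, Algebra.algebraMap_eq_smul_one]
      algebra
  · refine ⟨?_, ?_, ?_⟩
    · simp [opK, opK₃, opK₄, opK₂, scalarAdjoint, ofLocal, dInv, totalD_v, Algebra.smul_def, mul_comm]
    · simp [v]
    · simp [opK, opK₃, opK₄, ofLocal, dInv, rhs, localApply_add, localApply_mono,
        localApply_zero_right]
      simp only [← MvPolynomial.algebraMap_eq, Algebra.algebraMap_eq_smul_one]
      algebra

theorem hasValue_opJ : HasValue opJ (varDeriv h₁) rhs := by
  rw [varDeriv_h₁]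
  refine ⟨0, fun i => ⟨?_, ?_, ?_⟩⟩
  · fin_cases i <;> simp [opJ, ofLocal]
  · simp
  · fin_cases i
    · simp [opJ, ofLocal, rhs, localApply_add, localApply_neg, localApply_mono, localApply_smul,
        compD_mono, totalD_u, totalD_v, totalD_ofNat, Derivation.leibniz_pow]
      algebra
    · simp [opJ, ofLocal, rhs, localApply_add, localApply_neg, localApply_mono, totalD_u, totalD_v,
        Derivation.leibniz_pow]
      algebra

theorem isHamiltonian_comb (a b : ℝ) : IsHamiltonian (a • opK + b • opJ) := by
  refine ⟨adjoint_smul_add_smul adjoint_opK adjoint_opJ a b, ?_⟩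
  have h := jacobiIdentity_comb a (b / 3)
  rwa [mul_div_cancel₀ b (three_ne_zero' ℝ)] at h

end BurgersSystem

theorem proposition1 :
    BurgersSystem.IsHamiltonian BurgersSystem.opJ ∧
    BurgersSystem.IsHamiltonian BurgersSystem.opK ∧
    BurgersSystem.Compatible BurgersSystem.opK BurgersSystem.opJ ∧
    BurgersSystem.HasValue BurgersSystem.opK
      (BurgersSystem.varDeriv BurgersSystem.h₀) BurgersSystem.rhs ∧
    BurgersSystem.HasValue BurgersSystem.opJ
      (BurgersSystem.varDeriv BurgersSystem.h₁) BurgersSystem.rhs := by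
  have key (a b : ℝ) :
      BurgersSystem.IsHamiltonian (a • BurgersSystem.opK + b • BurgersSystem.opJ) :=
    BurgersSystem.isHamiltonian_comb a b
  exact ⟨by simpa using key 0 1, by simpa using key 1 0, key, BurgersSystem.hasValue_opK,
    BurgersSystem.hasValue_opJ⟩
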